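/- Notation. Let $O\subseteq\mathbb{R}^2$ be open and let $f\in C^\infty(O)$. Let $\mathcal{M}_f$ be the Lorentzian manifold $M=O\times\mathbb{R}$ with coordinates $(x,y,\tilde x)$ and metric $$g(\partial_x,\partial_x)=-2f(x,y),\qquad g(\partial_x,\partial_{\tilde x})=g(\partial_y,\partial_y)=1,$$ all other components being zero. For a pseudo-Riemannian manifold $\mathcal M=(M,g)$ let $\nabla^\ell R$ be the $\ell$-th covariant derivative of the curvature tensor, a covariant tensor of rank $\ell+4$. $\mathcal M$ is *homothety $k$-curvature homogeneous* if for all $P,Q\in M$ there are a linear isometry $\Phi:T_PM\to T_QM$ and a real $\lambda\neq0$ with $\Phi^*(\nabla^\ell R_Q)=\lambda^{-\ell-2}\,\nabla^\ell R_P$ for $0\le\ell\le k$. $\mathcal M$ is *homogeneous* (respectively *homothety homogeneous*) if the diffeomorphisms $T$ of $M$ with $T^*g=g$ (respectively with $T^*g=\lambda^2g$ for some real constant $\lambda\ne0$) act transitively on $M$. It is *locally homogeneous* if for all $P,Q\in M$ there is an isometry from a neighbourhood of $P$ onto a neighbourhood of $Q$ taking $P$ to $Q$. $\mathcal M$ is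 *locally isometric* to $\mathcal N$ if every point of $M$ has a neighbourhood isometric to an open subset of $\mathcal N$. **Theorem 1.9.** Let $O\subseteq\mathbb{R}^2$ be open, connected and non-empty, and let $f\in C^\infty(O)$ be such that $f_{yy}$ is never zero and is not constant on $O$. 1. If $f_{yyy}$ never vanishes, then $\mathcal{M}_f$ is homothety $1$-curvature homogeneous. 2. Suppose that every vertical slice $\{y:(x,y)\in O\}$ is connected, and that $f_{yy}=\alpha(x)$ depends only on $x$, with $\alpha_x$ never zero. Then $\mathcal{M}_f$ is homothety $1$-curvature homogeneous if and only if $$f=a(x-x_0)^{-2}y^2+\beta(x)y+\gamma(x)\quad\text{on }O$$ for some real $a\ne0$, some $x_0\in\mathbb{R}$ that is not the $x$-coordinate of a point of $O$, and some smooth functions $\beta,\gamma$ on the projection of $O$ to the $x$-axis. In that case $\mathcal{M}_f$ is locally homogeneous. 3. If $f_{yyy}$ never vanishes and $\mathcal{M}_f$ is homothety $2$-curvature homogeneous, then $\mathcal{M}_f$ is locally isometric to one of the following manifolds: (a) $\mathcal{M}_{\pm e^{ay}}$ on $\mathbb{R}^3$, for some real $a\ne0$; (b) $\mathcal{M}_{\pm\ln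 y}$ on $\mathbb{R}\times(0,\infty)\times\mathbb{R}$; (c) $\mathcal{M}_{\pm y^\varepsilon}$ on $\mathbb{R}\times(0,\infty)\times\mathbb{R}$, for some real $\varepsilon\ne0,1,2$. Moreover, for both signs, every manifold in (a) is homogeneous, and every manifold in (b) and (c) is homothety homogeneous but not locally homogeneous. -/

import Mathlib

open scoped ContDiff

noncomputable section

/-- An open subset of `ℝⁿ` with a smooth pseudo-Riemannian metric: a pseudo-Riemannian manifold
covered by one chart. The value `metric p` is the Gram matrix of the coordinate frame at `p`; it is
only meaningful for `p ∈ carrier`. -/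
structure PseudoRiemannianDomain (n : ℕ) where
  carrier : Set (Fin n → ℝ)
  isOpen_carrier : IsOpen carrier
  metric : (Fin n → ℝ) → Matrix (Fin n) (Fin n) ℝ
  smooth_metric : ∀ i j, ContDiffOn ℝ ∞ (fun p => metric p i j) carrier
  symm_metric : ∀ p ∈ carrier, (metric p).IsSymm
  nondegenerate_metric : ∀ p ∈ carrier, (metric p).det ≠ 0

/-- The partial derivative `∂φ/∂pⁱ`. -/
def partialD {n : ℕ} (i : Fin n) (φ : (Fin n → ℝ) → ℝ) (p : Fin n → ℝ) : ℝ :=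
  fderiv ℝ φ p (Pi.single i 1)

namespace PseudoRiemannianDomain

variable {n : ℕ}

/-- The inner product `g_p(u, v)` on the tangent space `T_p M = ℝⁿ`. -/
def innerAt (M : PseudoRiemannianDomain n) (p u v : Fin n → ℝ) : ℝ :=
  ∑ i, ∑ j, M.metric p i j * u i * v j

/-- Christoffel symbols of the Levi-Civita connection: `∇_{∂ᵢ} ∂ⱼ = ∑ₖ (christoffel p i j k) ∂ₖ`. -/
def christoffel (M : PseudoRiemannianDomain n) (p : Fin n → ℝ) (i j k : Fin n) : ℝ :=
  (1 / 2 : ℝ) * ∑ l, (M.metric p)⁻¹ k l *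
    (partialD i (fun q => M.metric q j l) p + partialD j (fun q => M.metric q i l) p
      - partialD l (fun q => M.metric q i j) p)

/-- The curvature operator: `∇_{∂ᵢ}∇_{∂ⱼ}∂ₖ - ∇_{∂ⱼ}∇_{∂ᵢ}∂ₖ = ∑ₗ (curvatureOp p i j k l) ∂ₗ`. -/
def curvatureOp (M : PseudoRiemannianDomain n) (p : Fin n → ℝ) (i j k l : Fin n) : ℝ :=
  partialD i (fun q => M.christoffel q j k l) p - partialD j (fun q => M.christoffel q i k l) p
    + ∑ m, (M.christoffel p j k m * M.christoffel p i m l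
      - M.christoffel p i k m * M.christoffel p j m l)

/-- The covariant derivative of a covariant `r`-tensor field given by its components in the
coordinate frame; the direction of differentiation is the last argument. -/
def covDeriv (M : PseudoRiemannianDomain n) {r : ℕ}
    (T : (Fin n → ℝ) → (Fin r → Fin n) → ℝ) :
    (Fin n → ℝ) → (Fin (r + 1) → Fin n) → ℝ :=
  fun p I => partialD (I (Fin.last r)) (fun q => T q (Fin.init I)) p
    - ∑ s : Fin r, ∑ m : Fin n,
        M.christoffel p (I (Fin.last r)) (I s.castSucc) m * T p (Function.update (Fin.init I) s m)

/-- Components of `∇ᵏR`, where `R(x₁,x₂,x₃,x₄) = g(𝕽(x₁,x₂)x₃, x₄)` for the curvature operator `𝕽`;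
the last `k` arguments are the directions of differentiation. -/
def nablaR (M : PseudoRiemannianDomain n) :
    (k : ℕ) → (Fin n → ℝ) → (Fin (4 + k) → Fin n) → ℝ
  | 0 => fun p I => ∑ m, M.curvatureOp p (I 0) (I 1) (I 2) m * M.metric p m (I 3)
  | k + 1 => M.covDeriv (M.nablaR k)

/-- The value of `∇ᵏR` at the point `p` on `4 + k` tangent vectors. -/
def nablaRAt (M : PseudoRiemannianDomain n) (k : ℕ) (p : Fin n → ℝ)
    (v : Fin (4 + k) → Fin n → ℝ) : ℝ :=
  ∑ I : Fin (4 + k) → Fin n, M.nablaR k p I * ∏ s, v s (I s)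

/-- Homothety `k`-curvature homogeneity: for any two points `P, Q` there are a linear isometry
`Φ : T_P M → T_Q M` and `lam ≠ 0` with `Φ^*(∇^ℓ R_Q) = lam^(-ℓ-2) ∇^ℓ R_P` for all `ℓ ≤ k`. -/
def IsHomothetyCurvatureHomogeneous (M : PseudoRiemannianDomain n) (k : ℕ) : Prop :=
  ∀ P ∈ M.carrier, ∀ Q ∈ M.carrier,
    ∃ (Φ : (Fin n → ℝ) ≃ₗ[ℝ] (Fin n → ℝ)) (lam : ℝ), lam ≠ 0 ∧
      (∀ u v, M.innerAt Q (Φ u) (Φ v) = M.innerAt P u v) ∧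
      ∀ ℓ ≤ k, ∀ v : Fin (4 + ℓ) → Fin n → ℝ,
        M.nablaRAt ℓ Q (fun s => Φ (v s)) = (lam ^ (ℓ + 2))⁻¹ * M.nablaRAt ℓ P v

/-- `T` is a smooth diffeomorphism from an open subset of `M` onto an open subset of `N` such that
`T^* g_N = c g_M`. -/
structure IsLocalHomothety (M N : PseudoRiemannianDomain n) (c : ℝ)
    (T : OpenPartialHomeomorph (Fin n → ℝ) (Fin n → ℝ)) : Prop where
  source_subset : T.source ⊆ M.carrier
  target_subset : T.target ⊆ N.carrier
  smooth : ContDiffOn ℝ ∞ T T.source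
  smooth_symm : ContDiffOn ℝ ∞ T.symm T.target
  pullback_metric : ∀ p ∈ T.source, ∀ u v,
    N.innerAt (T p) (fderiv ℝ T p u) (fderiv ℝ T p v) = c * M.innerAt p u v

/-- Every point of `M` has a neighbourhood isometric to an open subset of `N`. -/
def IsLocallyIsometricTo (M N : PseudoRiemannianDomain n) : Prop :=
  ∀ P ∈ M.carrier, ∃ T, M.IsLocalHomothety N 1 T ∧ P ∈ T.source

/-- For any two points of `M`, a local isometry of `M` takes the first to the second. -/
def IsLocallyHomogeneous (M : PseudoRiemannianDomain n) : Prop :=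
  ∀ P ∈ M.carrier, ∀ Q ∈ M.carrier, ∃ T, M.IsLocalHomothety M 1 T ∧ P ∈ T.source ∧ T P = Q

/-- The group of isometries of `M` acts transitively on `M`. -/
def IsHomogeneous (M : PseudoRiemannianDomain n) : Prop :=
  ∀ P ∈ M.carrier, ∀ Q ∈ M.carrier, ∃ T, M.IsLocalHomothety M 1 T ∧
    T.source = M.carrier ∧ T.target = M.carrier ∧ T P = Q

/-- The group of homotheties of `M` acts transitively on `M`. -/
def IsHomothetyHomogeneous (M : PseudoRiemannianDomain n) : Prop :=
  ∀ P ∈ M.carrier, ∀ Q ∈ M.carrier, ∃ (lam : ℝ) (T : _), lam ≠ 0 ∧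
    M.IsLocalHomothety M (lam ^ 2) T ∧
    T.source = M.carrier ∧ T.target = M.carrier ∧ T P = Q

end PseudoRiemannianDomain

/-- The Walker manifold `M_f` on `O × ℝ`, with coordinates `(x, y, x̃) = (p 0, p 1, p 2)` and
`g(∂x,∂x) = -2 f(x,y)`, `g(∂x,∂x̃) = g(∂y,∂y) = 1`, the other components being zero. -/
def walker (O : Set (ℝ × ℝ)) (hO : IsOpen O) (f : ℝ → ℝ → ℝ)
    (hf : ContDiffOn ℝ ∞ (Function.uncurry f) O) : PseudoRiemannianDomain 3 where
  carrier := {p | (p 0, p 1) ∈ O}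
  isOpen_carrier := hO.preimage (by fun_prop)
  metric p := !![-2 * f (p 0) (p 1), 0, 1; 0, 1, 0; 1, 0, 0]
  smooth_metric := by
    have h : ContDiffOn ℝ ∞ (fun p : Fin 3 → ℝ => f (p 0) (p 1)) {p | (p 0, p 1) ∈ O} :=
      hf.comp (f := fun p : Fin 3 → ℝ => (p 0, p 1)) (ContDiff.contDiffOn (by fun_prop))
        (fun p hp => hp)
    intro i j
    fin_cases i <;> fin_cases j <;> simp [contDiffOn_const]
    exact (contDiffOn_const.mul h).neg
  symm_metric p _ := by
    ext i j
    fin_cases i <;> fin_cases j <;> simp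
  nondegenerate_metric p _ := by
    simp [Matrix.det_fin_three]

/-- The partial derivative of a function of two real variables in its second variable `y`. -/
def dY (f : ℝ → ℝ → ℝ) (x y : ℝ) : ℝ := deriv (fun t => f x t) y

/-- `M_{s e^{ay}}` on `ℝ³`. -/
def walkerExp (s a : ℝ) : PseudoRiemannianDomain 3 :=
  walker Set.univ isOpen_univ (fun _ y => s * Real.exp (a * y))
    (ContDiff.contDiffOn (by unfold Function.uncurry; fun_prop))

/-- `M_{s ln y}` on `ℝ × (0,∞) × ℝ`. -/
def walkerLog (s : ℝ) : PseudoRiemannianDomain 3 :=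
  walker {q | 0 < q.2} (isOpen_lt continuous_const continuous_snd) (fun _ y => s * Real.log y)
    (contDiffOn_const.mul (contDiff_snd.contDiffOn.log fun _ hq => ne_of_gt hq))

/-- `M_{s y^ε}` on `ℝ × (0,∞) × ℝ`. -/
def walkerPow (s ε : ℝ) : PseudoRiemannianDomain 3 :=
  walker {q | 0 < q.2} (isOpen_lt continuous_const continuous_snd) (fun _ y => s * y ^ ε)
    (contDiffOn_const.mul (contDiff_snd.contDiffOn.rpow_const_of_ne fun _ hq => ne_of_gt hq))

/-- `f(x,y) = a (x - x₀)⁻² y² + β(x) y + γ(x)` on `O`, for some `a ≠ 0`, some `x₀`, and some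
functions `β`, `γ` that are smooth on the projection of `O` to the `x`-axis. -/
def IsInverseSquareQuadratic (O : Set (ℝ × ℝ)) (f : ℝ → ℝ → ℝ) : Prop :=
  ∃ (a x₀ : ℝ) (β γ : ℝ → ℝ), a ≠ 0 ∧ ContDiffOn ℝ ∞ β (Prod.fst '' O) ∧
    ContDiffOn ℝ ∞ γ (Prod.fst '' O) ∧
    ∀ q ∈ O, q.1 ≠ x₀ ∧
      f q.1 q.2 = a * ((q.1 - x₀) ^ 2)⁻¹ * q.2 ^ 2 + β q.1 * q.2 + γ q.1

end

/-! Write `h = f_yy`. The form `dx` is parallel and `∇dy` is a multiple of `dx ⊗ dx`, so `dx ∧ dy`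
is parallel. Hence `R = -h (dx ∧ dy) ⊗ (dx ∧ dy)`, and `∇R`, `∇²R` arise by replacing `h` with `dh`
and `Hess h`. A linear isometry that matches `R` up to a factor preserves the line of `∂x̃`, pulls
`dx` back to `a dx` and `dy` to `b dx + σ dy` with `σ² = 1` (`exists_frame`). Curvature homogeneity
thus becomes the algebra of `JetRelation` and `JetRelationTwo`; conversely, every admissible `a, b,
σ` comes from an isometry.

If `h_y ≠ 0`, the first-order relations can be solved for `a`, `lam` and `b`, which is (1). If `h =
α(x)`, they make `α'² / α³` constant, and this equation has only inverse-square solutions with `α' ≠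
0` (`exists_eq_inv_sq`). Such a potential is invariant under dilations about `x₀`, and the linear
term in `y` is corrected by a shift `φ(x)` of `y` that solves a linear equation of second order, so
the manifold is locally homogeneous.

For (3), three scalar invariants of the second-order model are constant
(`JetRelationTwo.invariants`). They force `h_y = e |h|^κ` with `κ ≠ 2`, and `f_y = ∂x(h_x / h_y) +
h² / ((2 - κ) h_y)` (`exists_normal_form`). A primitive of `± 1 / h_y`, regarded as a function of
`h`, is a new coordinate `Y` with `Y_y = ±1`; the first term of `f_y` is then `± Y_xx`, which a
shift of `y` absorbs, and the second is a function of `Y`. It is exponential for `κ = 1` and a power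
of `Y` otherwise.

The isometries and homotheties needed all have the shape `fibreMap`. In the other direction, a local
isometry of a metric with `f = g(y)` preserves `(g''' / g'')²`, which is not constant for logarithms
and powers, so these are not locally homogeneous. -/

noncomputable section

/-! ### Calculus of smooth functions of `(x, y)`. -/

/-- The partial derivative of a function of two real variables in its first variable `x`. -/
def dX (f : ℝ → ℝ → ℝ) (x y : ℝ) : ℝ := deriv (fun t => f t y) x

/-- Smoothness on `O` of a function of two real variables. -/
def SmoothOn (O : Set (ℝ × ℝ)) (φ : ℝ → ℝ → ℝ) : Prop :=
  ContDiffOn ℝ ∞ (Function.uncurry φ) O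

namespace SmoothOn

variable {O : Set (ℝ × ℝ)} {φ χ : ℝ → ℝ → ℝ}

theorem differentiableAt (h : SmoothOn O φ) (hO : IsOpen O) {x y : ℝ} (hq : (x, y) ∈ O) :
    DifferentiableAt ℝ (Function.uncurry φ) (x, y) :=
  (ContDiffOn.contDiffAt h (hO.mem_nhds hq)).differentiableAt (by simp)

theorem hasDerivAt_fst (h : SmoothOn O φ) (hO : IsOpen O) {x y : ℝ} (hq : (x, y) ∈ O) :
    HasDerivAt (fun t => φ t y) (fderiv ℝ (Function.uncurry φ) (x, y) (1, 0)) x := by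
  have h1 := (h.differentiableAt hO hq).hasFDerivAt
  exact h1.comp_hasDerivAt (f := fun t : ℝ => (t, y)) x
    ((hasDerivAt_id x).prodMk (hasDerivAt_const x y))

theorem hasDerivAt_snd (h : SmoothOn O φ) (hO : IsOpen O) {x y : ℝ} (hq : (x, y) ∈ O) :
    HasDerivAt (fun t => φ x t) (fderiv ℝ (Function.uncurry φ) (x, y) (0, 1)) y := by
  have h1 := (h.differentiableAt hO hq).hasFDerivAt
  exact h1.comp_hasDerivAt (f := fun t : ℝ => (x, t)) y
    ((hasDerivAt_const y x).prodMk (hasDerivAt_id y))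

theorem dX_eq (h : SmoothOn O φ) (hO : IsOpen O) {x y : ℝ} (hq : (x, y) ∈ O) :
    dX φ x y = fderiv ℝ (Function.uncurry φ) (x, y) (1, 0) :=
  (h.hasDerivAt_fst hO hq).deriv

theorem dY_eq (h : SmoothOn O φ) (hO : IsOpen O) {x y : ℝ} (hq : (x, y) ∈ O) :
    dY φ x y = fderiv ℝ (Function.uncurry φ) (x, y) (0, 1) :=
  (h.hasDerivAt_snd hO hq).deriv

theorem hasDerivAt_dX (h : SmoothOn O φ) (hO : IsOpen O) {x y : ℝ} (hq : (x, y) ∈ O) :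
    HasDerivAt (fun t => φ t y) (dX φ x y) x :=
  h.dX_eq hO hq ▸ h.hasDerivAt_fst hO hq

theorem hasDerivAt_dY (h : SmoothOn O φ) (hO : IsOpen O) {x y : ℝ} (hq : (x, y) ∈ O) :
    HasDerivAt (fun t => φ x t) (dY φ x y) y :=
  h.dY_eq hO hq ▸ h.hasDerivAt_snd hO hq

theorem dX (h : SmoothOn O φ) (hO : IsOpen O) : SmoothOn O (dX φ) := by
  have h1 : ContDiffOn ℝ ∞ (fderiv ℝ (Function.uncurry φ)) O :=
    ContDiffOn.fderiv_of_isOpen h hO (by simp)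
  refine (h1.clm_apply (contDiffOn_const (c := ((1 : ℝ), (0 : ℝ))))).congr ?_
  rintro ⟨x, y⟩ hq
  exact h.dX_eq hO hq

theorem dY (h : SmoothOn O φ) (hO : IsOpen O) : SmoothOn O (dY φ) := by
  have h1 : ContDiffOn ℝ ∞ (fderiv ℝ (Function.uncurry φ)) O :=
    ContDiffOn.fderiv_of_isOpen h hO (by simp)
  refine (h1.clm_apply (contDiffOn_const (c := ((0 : ℝ), (1 : ℝ))))).congr ?_
  rintro ⟨x, y⟩ hq
  exact h.dY_eq hO hq

theorem hasFDerivAt (h : SmoothOn O φ) (hO : IsOpen O) {x y : ℝ} (hq : (x, y) ∈ O) :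
    HasFDerivAt (Function.uncurry φ)
      (_root_.dX φ x y • ContinuousLinearMap.fst ℝ ℝ ℝ
        + _root_.dY φ x y • ContinuousLinearMap.snd ℝ ℝ ℝ) (x, y) := by
  convert (h.differentiableAt hO hq).hasFDerivAt using 1
  ext <;> simp [h.dX_eq hO hq, h.dY_eq hO hq]

theorem dX_dY_comm (h : SmoothOn O φ) (hO : IsOpen O) {x y : ℝ} (hq : (x, y) ∈ O) :
    _root_.dX (_root_.dY φ) x y = _root_.dY (_root_.dX φ) x y := by
  have hs : IsSymmSndFDerivAt ℝ (Function.uncurry φ) (x, y) :=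
    (ContDiffOn.contDiffAt h (hO.mem_nhds hq)).isSymmSndFDerivAt
      (by simp only [minSmoothness_of_isRCLikeNormedField]; exact WithTop.coe_le_coe.2 (le_top : (2 : ℕ∞) ≤ ⊤))
  have hd : DifferentiableAt ℝ (fderiv ℝ (Function.uncurry φ)) (x, y) :=
    ((ContDiffOn.fderiv_of_isOpen (m := ∞) h hO (by simp)).contDiffAt
      (hO.mem_nhds hq)).differentiableAt (by simp)
  have hev : ∀ᶠ q in nhds (x, y), q ∈ O := hO.mem_nhds hq
  have hx : Function.uncurry (_root_.dX φ) =ᶠ[nhds (x, y)]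
      fun q => fderiv ℝ (Function.uncurry φ) q (1, 0) := by
    filter_upwards [hev] with q hq using h.dX_eq hO hq
  have hy : Function.uncurry (_root_.dY φ) =ᶠ[nhds (x, y)]
      fun q => fderiv ℝ (Function.uncurry φ) q (0, 1) := by
    filter_upwards [hev] with q hq using h.dY_eq hO hq
  rw [(h.dY hO).dX_eq hO hq, (h.dX hO).dY_eq hO hq, hx.fderiv_eq, hy.fderiv_eq,
    fderiv_clm_apply hd (by fun_prop), fderiv_clm_apply hd (by fun_prop)]
  simpa using hs (1, 0) (0, 1)

end SmoothOn

theorem dX_congr {O : Set (ℝ × ℝ)} (hO : IsOpen O) {φ χ : ℝ → ℝ → ℝ}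
    (h : ∀ x y, (x, y) ∈ O → φ x y = χ x y) {x y : ℝ} (hq : (x, y) ∈ O) :
    dX φ x y = dX χ x y := by
  apply Filter.EventuallyEq.deriv_eq
  have : ContinuousAt (fun t : ℝ => (t, y)) x := by fun_prop
  filter_upwards [this (hO.mem_nhds hq)] with t ht using h t y ht

theorem dY_congr {O : Set (ℝ × ℝ)} (hO : IsOpen O) {φ χ : ℝ → ℝ → ℝ}
    (h : ∀ x y, (x, y) ∈ O → φ x y = χ x y) {x y : ℝ} (hq : (x, y) ∈ O) :
    dY φ x y = dY χ x y := by
  apply Filter.EventuallyEq.deriv_eq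
  have : ContinuousAt (fun t : ℝ => (x, t)) y := by fun_prop
  filter_upwards [this (hO.mem_nhds hq)] with t ht using h x t ht

theorem SmoothOn.eq_of_dX_dY_eq_zero {O : Set (ℝ × ℝ)} (hO : IsOpen O) (hc : IsPreconnected O)
    {φ : ℝ → ℝ → ℝ} (h : SmoothOn O φ) (hx : ∀ x y, (x, y) ∈ O → _root_.dX φ x y = 0)
    (hy : ∀ x y, (x, y) ∈ O → _root_.dY φ x y = 0) {p q : ℝ × ℝ} (hp : p ∈ O) (hq : q ∈ O) :
    φ p.1 p.2 = φ q.1 q.2 := by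
  refine hO.is_const_of_fderiv_eq_zero (f := Function.uncurry φ) (𝕜 := ℝ) hc
    (fun z hz => (h.differentiableAt hO (x := z.1) (y := z.2) hz).differentiableWithinAt) ?_ hp hq
  rintro ⟨x, y⟩ hz
  simp [(h.hasFDerivAt hO hz).fderiv, hx x y hz, hy x y hz]

section PartialD

variable {O : Set (ℝ × ℝ)} {φ : ℝ → ℝ → ℝ}

theorem SmoothOn.hasFDerivAt_coords (h : SmoothOn O φ) (hO : IsOpen O) {p : Fin 3 → ℝ}
    (hp : (p 0, p 1) ∈ O) :
    HasFDerivAt (fun q : Fin 3 → ℝ => φ (q 0) (q 1))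
      (_root_.dX φ (p 0) (p 1) • ContinuousLinearMap.proj (R := ℝ) (φ := fun _ : Fin 3 => ℝ) 0
        + _root_.dY φ (p 0) (p 1) • ContinuousLinearMap.proj (R := ℝ) (φ := fun _ : Fin 3 => ℝ) 1)
      p := by
  have h1 : HasFDerivAt (fun q : Fin 3 → ℝ => (q 0, q 1))
      ((ContinuousLinearMap.proj (R := ℝ) (φ := fun _ : Fin 3 => ℝ) 0).prod
        (ContinuousLinearMap.proj (R := ℝ) (φ := fun _ : Fin 3 => ℝ) 1)) p :=
    (hasFDerivAt_apply 0 p).prodMk (hasFDerivAt_apply 1 p)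
  refine (HasFDerivAt.comp (g := Function.uncurry φ) p (h.hasFDerivAt hO hp) h1).congr_fderiv ?_
  ext v
  simp

/-- The derivative in the coordinate direction `i` of a function of `(x, y)`. -/
def coordD (φ : ℝ → ℝ → ℝ) (i : Fin 3) : ℝ → ℝ → ℝ :=
  ![dX φ, dY φ, fun _ _ => 0] i

theorem SmoothOn.partialD_coords (h : SmoothOn O φ) (hO : IsOpen O) {p : Fin 3 → ℝ}
    (hp : (p 0, p 1) ∈ O) (i : Fin 3) :
    partialD i (fun q : Fin 3 → ℝ => φ (q 0) (q 1)) p = coordD φ i (p 0) (p 1) := by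
  rw [partialD, (h.hasFDerivAt_coords hO hp).fderiv]
  fin_cases i <;> simp [coordD]

theorem SmoothOn.coordD (h : SmoothOn O φ) (hO : IsOpen O) (i : Fin 3) :
    SmoothOn O (coordD φ i) := by
  fin_cases i
  · exact h.dX hO
  · exact h.dY hO
  · exact contDiffOn_const

end PartialD

theorem partialD_congr {n : ℕ} {U : Set (Fin n → ℝ)} (hU : IsOpen U) {φ χ : (Fin n → ℝ) → ℝ}
    (h : ∀ p ∈ U, φ p = χ p) {p : Fin n → ℝ} (hp : p ∈ U) (i : Fin n) :
    partialD i φ p = partialD i χ p := by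
  rw [partialD, partialD, Filter.EventuallyEq.fderiv_eq]
  filter_upwards [hU.mem_nhds hp] with q hq using h q hq

/-! ### Curvature of Walker metrics and its first two covariant derivatives. -/

section Walker

variable {O : Set (ℝ × ℝ)} {hO : IsOpen O} {f : ℝ → ℝ → ℝ}
  {hf : ContDiffOn ℝ ∞ (Function.uncurry f) O}

theorem walker_metric_inv (p : Fin 3 → ℝ) :
    ((walker O hO f hf).metric p)⁻¹ = !![0, 0, 1; 0, 1, 0; 1, 0, 2 * f (p 0) (p 1)] := by
  apply Matrix.inv_eq_right_inv
  ext i j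
  fin_cases i <;> fin_cases j <;> simp [walker, Matrix.mul_apply, Fin.sum_univ_three]

theorem walker_innerAt (p u v : Fin 3 → ℝ) :
    (walker O hO f hf).innerAt p u v
      = -2 * f (p 0) (p 1) * u 0 * v 0 + u 0 * v 2 + u 2 * v 0 + u 1 * v 1 := by
  simp [PseudoRiemannianDomain.innerAt, walker, Fin.sum_univ_three]
  ring

theorem partialD_walker_metric {p : Fin 3 → ℝ} (hp : (p 0, p 1) ∈ O) (i j k : Fin 3) :
    partialD i (fun q => (walker O hO f hf).metric q j k) p
      = if j = 0 ∧ k = 0 then -2 * coordD f i (p 0) (p 1) else 0 := by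
  have hf' : SmoothOn O f := hf
  split_ifs with h
  · obtain ⟨rfl, rfl⟩ := h
    have := (hf'.hasFDerivAt_coords hO hp).const_mul (-2)
    rw [partialD, ← hf'.partialD_coords hO hp, partialD]
    simp only [walker, Matrix.of_apply, Matrix.cons_val_zero, Matrix.cons_val', this.fderiv,
      (hf'.hasFDerivAt_coords hO hp).fderiv]
    simp
    ring
  · have : (fun q => (walker O hO f hf).metric q j k)
        = fun _ => (walker O hO f hf).metric p j k := by
      funext q
      fin_cases j <;> fin_cases k <;> simp [walker] at h ⊢
    rw [this, partialD]
    simp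

/-- The Christoffel symbols of a Walker metric as functions of `(x, y)`. -/
def walkerGamma (f : ℝ → ℝ → ℝ) (i j k : Fin 3) : ℝ → ℝ → ℝ :=
  ![![![0, dY f, -dX f], ![0, 0, -dY f], ![0, 0, 0]],
    ![![0, 0, -dY f], ![0, 0, 0], ![0, 0, 0]],
    ![![0, 0, 0], ![0, 0, 0], ![0, 0, 0]]] i j k

theorem walker_christoffel {p : Fin 3 → ℝ} (hp : (p 0, p 1) ∈ O) (i j k : Fin 3) :
    (walker O hO f hf).christoffel p i j k = walkerGamma f i j k (p 0) (p 1) := by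
  rw [PseudoRiemannianDomain.christoffel]
  simp only [partialD_walker_metric hp, walker_metric_inv, Fin.sum_univ_three]
  fin_cases i <;> fin_cases j <;> fin_cases k <;> simp [walkerGamma, coordD]

theorem SmoothOn.walkerGamma (h : SmoothOn O f) (hO : IsOpen O) (i j k : Fin 3) :
    SmoothOn O (walkerGamma f i j k) := by
  have h0 : SmoothOn O fun _ _ => (0 : ℝ) := contDiffOn_const
  have h1 : SmoothOn O fun x y => -_root_.dX f x y := ContDiffOn.neg (h.dX hO)
  have h2 : SmoothOn O fun x y => -_root_.dY f x y := ContDiffOn.neg (h.dY hO)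
  fin_cases i <;> fin_cases j <;> fin_cases k <;>
    first | exact h0 | exact h1 | exact h2 | exact h.dY hO

theorem partialD_walker_christoffel {p : Fin 3 → ℝ} (hp : (p 0, p 1) ∈ O) (l i j k : Fin 3) :
    partialD l (fun q => (walker O hO f hf).christoffel q i j k) p
      = coordD (walkerGamma f i j k) l (p 0) (p 1) := by
  have hf' : SmoothOn O f := hf
  rw [← (hf'.walkerGamma hO i j k).partialD_coords hO hp]
  exact partialD_congr (walker O hO f hf).isOpen_carrier (fun q hq => walker_christoffel hq i j k)
    hp l

/-- The components of `dx ∧ dy`. -/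
def areaIdx (i j : Fin 3) : ℝ :=
  !![0, 1, 0; -1, 0, 0; 0, 0, 0] i j

theorem coordD_zero (i : Fin 3) (x y : ℝ) : coordD 0 i x y = 0 := by
  fin_cases i <;> simp [coordD, dX, dY]

theorem coordD_neg (φ : ℝ → ℝ → ℝ) (i : Fin 3) (x y : ℝ) :
    coordD (-φ) i x y = -coordD φ i x y := by
  fin_cases i <;> simp [coordD, dX, dY]

theorem walker_curvatureOp {p : Fin 3 → ℝ} (hp : (p 0, p 1) ∈ O) (i j k l : Fin 3) :
    (walker O hO f hf).curvatureOp p i j k l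
      = areaIdx i j * dY (dY f) (p 0) (p 1) * (![![0, -1, 0], ![0, 0, 1], ![0, 0, 0]] k l) := by
  have hf' : SmoothOn O f := hf
  have hc := hf'.dX_dY_comm hO hp
  rw [PseudoRiemannianDomain.curvatureOp]
  simp only [partialD_walker_christoffel hp, walker_christoffel hp, Fin.sum_univ_three]
  fin_cases i <;> fin_cases j <;> fin_cases k <;> fin_cases l <;>
    simp [walkerGamma, areaIdx, coordD_zero, coordD_neg] <;>
    simp [coordD, hc]

theorem walker_nablaR_zero {p : Fin 3 → ℝ} (hp : (p 0, p 1) ∈ O) (I : Fin 4 → Fin 3) :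
    (walker O hO f hf).nablaR 0 p I
      = areaIdx (I 0) (I 1) * areaIdx (I 2) (I 3) * -dY (dY f) (p 0) (p 1) := by
  simp only [PseudoRiemannianDomain.nablaR, walker_curvatureOp hp, Fin.sum_univ_three]
  generalize I 0 = i, I 1 = j, I 2 = k, I 3 = l
  have : areaIdx k l = ![![0, 1, 0], ![-1, 0, 0], ![0, 0, 0]] k l := rfl
  rw [this]
  fin_cases k <;> fin_cases l <;> simp [walker]

/-- This is `∇(dx ∧ dy) = 0`: `dx` is parallel, and `∇dy` is a multiple of `dx ⊗ dx`, which dies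
when wedged with `dx`. -/
theorem areaIdx_parallel (f : ℝ → ℝ → ℝ) (x y : ℝ) (k i j : Fin 3) :
    walkerGamma f k i 0 x y * areaIdx 0 j + walkerGamma f k i 1 x y * areaIdx 1 j
      + walkerGamma f k i 2 x y * areaIdx 2 j + walkerGamma f k j 0 x y * areaIdx i 0
      + walkerGamma f k j 1 x y * areaIdx i 1 + walkerGamma f k j 2 x y * areaIdx i 2 = 0 := by
  fin_cases k <;> fin_cases i <;> fin_cases j <;> simp [walkerGamma, areaIdx]

/-- Only the coefficient `-h` gets differentiated, because the Christoffel corrections on the four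
curvature slots cancel in pairs by `areaIdx_parallel`. -/
theorem walker_nablaR_one {p : Fin 3 → ℝ} (hp : (p 0, p 1) ∈ O) (I : Fin 5 → Fin 3) :
    (walker O hO f hf).nablaR 1 p I
      = areaIdx (I 0) (I 1) * areaIdx (I 2) (I 3) * -coordD (dY (dY f)) (I 4) (p 0) (p 1) := by
  have hf' : SmoothOn O f := hf
  have hh := (hf'.dY hO).dY hO
  have h1 : partialD (I 4) (fun q => (walker O hO f hf).nablaR 0 q (Fin.init I)) p
      = areaIdx (I 0) (I 1) * areaIdx (I 2) (I 3) * -coordD (dY (dY f)) (I 4) (p 0) (p 1) := by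
    rw [partialD_congr (walker O hO f hf).isOpen_carrier
      (fun q hq => walker_nablaR_zero (hf := hf) hq (Fin.init I)) hp, ← hh.partialD_coords hO hp]
    have h2 := (hh.hasFDerivAt_coords hO hp).fun_neg.const_mul
      (areaIdx (I 0) (I 1) * areaIdx (I 2) (I 3))
    rw [partialD, partialD, (hh.hasFDerivAt_coords hO hp).fderiv]
    refine (congrArg (fun L => L (Pi.single (I 4) 1)) h2.fderiv).trans ?_
    simp
    ring
  change partialD (I 4) (fun q => (walker O hO f hf).nablaR 0 q (Fin.init I)) p - _ = _
  rw [h1]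
  -- An explicit index vector lets `Function.update` be evaluated entry by entry.
  have e : ∀ s : Fin 4, ∀ m, Function.update (Fin.init I : Fin 4 → Fin 3) s m
      = Function.update ![I 0, I 1, I 2, I 3] s m := by
    intro s m
    congr 1
    ext t
    fin_cases t <;> rfl
  have l : I (Fin.last 4) = I 4 := rfl
  have c0 : I (Fin.castSucc 0) = I 0 := rfl
  have c1 : I (Fin.castSucc 1) = I 1 := rfl
  have c2 : I (Fin.castSucc 2) = I 2 := rfl
  have c3 : I (Fin.castSucc 3) = I 3 := rfl
  simp only [walker_nablaR_zero hp, walker_christoffel hp, e, l]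
  rw [Fin.sum_univ_four]
  simp only [Fin.sum_univ_three, c0, c1, c2, c3]
  simp [Function.update]
  linear_combination -(areaIdx (I 2) (I 3) * dY (dY f) (p 0) (p 1)) *
      areaIdx_parallel f (p 0) (p 1) (I 4) (I 0) (I 1)
    - (areaIdx (I 0) (I 1) * dY (dY f) (p 0) (p 1)) *
      areaIdx_parallel f (p 0) (p 1) (I 4) (I 2) (I 3)

/-- The Hessian of a function of `(x, y)` with respect to the Walker metric. -/
def walkerHess (f φ : ℝ → ℝ → ℝ) (i j : Fin 3) (x y : ℝ) : ℝ :=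
  coordD (coordD φ i) j x y - ∑ m, walkerGamma f j i m x y * coordD φ m x y

/-- The correction on the fifth slot survives and turns the second derivatives of `h` into its
Hessian. -/
theorem walker_nablaR_two {p : Fin 3 → ℝ} (hp : (p 0, p 1) ∈ O) (I : Fin 6 → Fin 3) :
    (walker O hO f hf).nablaR 2 p I
      = areaIdx (I 0) (I 1) * areaIdx (I 2) (I 3) *
        -walkerHess f (dY (dY f)) (I 4) (I 5) (p 0) (p 1) := by
  have hf' : SmoothOn O f := hf
  have hh := ((hf'.dY hO).dY hO).coordD hO (I 4)
  have h1 : partialD (I 5) (fun q => (walker O hO f hf).nablaR 1 q (Fin.init I)) p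
      = areaIdx (I 0) (I 1) * areaIdx (I 2) (I 3) *
        -coordD (coordD (dY (dY f)) (I 4)) (I 5) (p 0) (p 1) := by
    rw [partialD_congr (walker O hO f hf).isOpen_carrier
      (fun q hq => walker_nablaR_one (hf := hf) hq (Fin.init I)) hp, ← hh.partialD_coords hO hp]
    have h2 := (hh.hasFDerivAt_coords hO hp).fun_neg.const_mul
      (areaIdx (I 0) (I 1) * areaIdx (I 2) (I 3))
    rw [partialD, partialD, (hh.hasFDerivAt_coords hO hp).fderiv]
    refine (congrArg (fun L => L (Pi.single (I 5) 1)) h2.fderiv).trans ?_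
    simp
    ring
  change partialD (I 5) (fun q => (walker O hO f hf).nablaR 1 q (Fin.init I)) p - _ = _
  rw [h1, walkerHess]
  have e : ∀ s : Fin 5, ∀ m, Function.update (Fin.init I : Fin 5 → Fin 3) s m
      = Function.update ![I 0, I 1, I 2, I 3, I 4] s m := by
    intro s m
    congr 1
    ext t
    fin_cases t <;> rfl
  have l : I (Fin.last 5) = I 5 := rfl
  have c0 : I (Fin.castSucc 0) = I 0 := rfl
  have c1 : I (Fin.castSucc 1) = I 1 := rfl
  have c2 : I (Fin.castSucc 2) = I 2 := rfl
  have c3 : I (Fin.castSucc 3) = I 3 := rfl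
  have c4 : I (Fin.castSucc 4) = I 4 := rfl
  simp only [walker_nablaR_one hp, walker_christoffel hp, e, l]
  rw [Fin.sum_univ_five]
  simp only [Fin.sum_univ_three, c0, c1, c2, c3, c4]
  simp [Function.update]
  linear_combination -(areaIdx (I 2) (I 3) * -coordD (dY (dY f)) (I 4) (p 0) (p 1)) *
      areaIdx_parallel f (p 0) (p 1) (I 5) (I 0) (I 1)
    - (areaIdx (I 0) (I 1) * -coordD (dY (dY f)) (I 4) (p 0) (p 1)) *
      areaIdx_parallel f (p 0) (p 1) (I 5) (I 2) (I 3)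

theorem sum_fun_cons {α : Type*} [Fintype α] {n : ℕ} (F : (Fin (n + 1) → α) → ℝ) :
    ∑ I, F I = ∑ i, ∑ I : Fin n → α, F (Matrix.vecCons i I) := by
  rw [← Fintype.sum_prod_type']
  refine (Fintype.sum_equiv (Fin.consEquiv fun _ => α) _ _ ?_).symm
  rintro ⟨i, I⟩
  rfl

theorem sum_fun_fin_zero {α : Type*} [Fintype α] (F : (Fin 0 → α) → ℝ) :
    ∑ I, F I = F ![] := by
  rw [Fintype.sum_unique]
  congr 1

/-- The value of `dx ∧ dy` on two vectors. -/
def area (u v : Fin 3 → ℝ) : ℝ := u 0 * v 1 - u 1 * v 0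

theorem walker_nablaRAt_zero {p : Fin 3 → ℝ} (hp : (p 0, p 1) ∈ O) (v : Fin 4 → Fin 3 → ℝ) :
    (walker O hO f hf).nablaRAt 0 p v
      = area (v 0) (v 1) * area (v 2) (v 3) * -dY (dY f) (p 0) (p 1) := by
  rw [PseudoRiemannianDomain.nablaRAt]
  simp only [walker_nablaR_zero hp]
  -- The index type `Fin (4 + 0)` is replaced by the definitionally equal `Fin 4`, so that the sum
  -- unfolds one index at a time.
  change ∑ I : Fin 4 → Fin 3, (areaIdx (I 0) (I 1) * areaIdx (I 2) (I 3) * _) *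
    ∏ s : Fin 4, v s (I s) = _
  simp only [Fin.prod_univ_four, sum_fun_cons, sum_fun_fin_zero]
  simp [Fin.sum_univ_three, areaIdx, area]
  ring

theorem walker_nablaRAt_one {p : Fin 3 → ℝ} (hp : (p 0, p 1) ∈ O) (v : Fin 5 → Fin 3 → ℝ) :
    (walker O hO f hf).nablaRAt 1 p v
      = area (v 0) (v 1) * area (v 2) (v 3) *
        -(dX (dY (dY f)) (p 0) (p 1) * v 4 0 + dY (dY (dY f)) (p 0) (p 1) * v 4 1) := by
  rw [PseudoRiemannianDomain.nablaRAt]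
  simp only [walker_nablaR_one hp]
  change ∑ I : Fin 5 → Fin 3, (areaIdx (I 0) (I 1) * areaIdx (I 2) (I 3) *
    -coordD (dY (dY f)) (I 4) (p 0) (p 1)) * ∏ s : Fin 5, v s (I s) = _
  simp only [Fin.prod_univ_five, sum_fun_cons, sum_fun_fin_zero]
  simp [Fin.sum_univ_three, areaIdx, area, coordD]
  ring

theorem walkerHess_zero_zero (φ : ℝ → ℝ → ℝ) (x y : ℝ) :
    walkerHess f φ 0 0 x y = dX (dX φ) x y - dY f x y * dY φ x y := by
  simp [walkerHess, walkerGamma, coordD, Fin.sum_univ_three]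

theorem walkerHess_zero_one (φ : ℝ → ℝ → ℝ) (x y : ℝ) :
    walkerHess f φ 0 1 x y = dY (dX φ) x y := by
  simp [walkerHess, walkerGamma, coordD, Fin.sum_univ_three]

theorem walkerHess_one_one (φ : ℝ → ℝ → ℝ) (x y : ℝ) :
    walkerHess f φ 1 1 x y = dY (dY φ) x y := by
  simp [walkerHess, walkerGamma, coordD, Fin.sum_univ_three]

theorem walkerHess_two_left (φ : ℝ → ℝ → ℝ) (i : Fin 3) (x y : ℝ) :
    walkerHess f φ 2 i x y = 0 := by
  fin_cases i <;> simp [walkerHess, walkerGamma, coordD, Fin.sum_univ_three, dX, dY]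

theorem walkerHess_two_right (φ : ℝ → ℝ → ℝ) (i : Fin 3) (x y : ℝ) :
    walkerHess f φ i 2 x y = 0 := by
  fin_cases i <;> simp [walkerHess, walkerGamma, coordD, Fin.sum_univ_three]

theorem walkerHess_one_zero {φ : ℝ → ℝ → ℝ} (h : SmoothOn O φ) (hO : IsOpen O)
    {x y : ℝ} (hq : (x, y) ∈ O) :
    walkerHess f φ 1 0 x y = dY (dX φ) x y := by
  simp [walkerHess, walkerGamma, coordD, Fin.sum_univ_three, h.dX_dY_comm hO hq]

theorem walker_nablaRAt_two {p : Fin 3 → ℝ} (hp : (p 0, p 1) ∈ O) (v : Fin 6 → Fin 3 → ℝ) :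
    (walker O hO f hf).nablaRAt 2 p v
      = area (v 0) (v 1) * area (v 2) (v 3) *
        -((dX (dX (dY (dY f))) (p 0) (p 1)
            - dY f (p 0) (p 1) * dY (dY (dY f)) (p 0) (p 1)) * v 4 0 * v 5 0
          + dY (dX (dY (dY f))) (p 0) (p 1) * (v 4 0 * v 5 1 + v 4 1 * v 5 0)
          + dY (dY (dY (dY f))) (p 0) (p 1) * v 4 1 * v 5 1) := by
  have hf' : SmoothOn O f := hf
  have h10 := walkerHess_one_zero (f := f) ((hf'.dY hO).dY hO) hO hp
  rw [PseudoRiemannianDomain.nablaRAt]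
  simp only [walker_nablaR_two hp]
  change ∑ I : Fin 6 → Fin 3, (areaIdx (I 0) (I 1) * areaIdx (I 2) (I 3) *
    -walkerHess f (dY (dY f)) (I 4) (I 5) (p 0) (p 1)) * ∏ s : Fin 6, v s (I s) = _
  simp only [Fin.prod_univ_six, sum_fun_cons, sum_fun_fin_zero]
  simp [Fin.sum_univ_three, areaIdx, area, walkerHess_two_left, walkerHess_two_right,
    walkerHess_zero_zero, walkerHess_zero_one, walkerHess_one_one, h10]
  ring
end Walker

/-! ### Homotheties of the curvature models. -/

section Frames

variable {O : Set (ℝ × ℝ)} {hO : IsOpen O} {f : ℝ → ℝ → ℝ}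
  {hf : ContDiffOn ℝ ∞ (Function.uncurry f) O}

/-- The relations between the `1`-jets of `h = f_yy` at `P` and `Q` that come from a
homothety of the models up to order one, where `dx` pulls back to `a dx` and `dy` to
`b dx + σ dy`. -/
structure JetRelation (h : ℝ → ℝ → ℝ) (P Q : ℝ × ℝ) (lam a b σ : ℝ) : Prop where
  lam_ne : lam ≠ 0
  a_ne : a ≠ 0
  sq_σ : σ ^ 2 = 1
  zero : a ^ 2 * lam ^ 2 * h Q.1 Q.2 = h P.1 P.2
  x : a ^ 2 * lam ^ 3 * (a * dX h Q.1 Q.2 + b * dY h Q.1 Q.2) = dX h P.1 P.2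
  y : a ^ 2 * lam ^ 3 * (σ * dY h Q.1 Q.2) = dY h P.1 P.2

/-- The relations between the `2`-jets. -/
structure JetRelationTwo (f : ℝ → ℝ → ℝ) (h : ℝ → ℝ → ℝ) (P Q : ℝ × ℝ) (lam a b σ : ℝ) : Prop
    extends JetRelation h P Q lam a b σ where
  xx : a ^ 2 * lam ^ 4 * (a ^ 2 * (dX (dX h) Q.1 Q.2 - dY f Q.1 Q.2 * dY h Q.1 Q.2)
    + 2 * a * b * dY (dX h) Q.1 Q.2 + b ^ 2 * dY (dY h) Q.1 Q.2)
      = dX (dX h) P.1 P.2 - dY f P.1 P.2 * dY h P.1 P.2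
  xy : a ^ 2 * lam ^ 4 * (σ * (a * dY (dX h) Q.1 Q.2 + b * dY (dY h) Q.1 Q.2))
      = dY (dX h) P.1 P.2
  yy : a ^ 2 * lam ^ 4 * dY (dY h) Q.1 Q.2 = dY (dY h) P.1 P.2

/-- The line of `∂x̃` is the kernel of `dx ∧ dy`, so it is determined by `R`; so is its orthogonal
complement, spanned by `∂y` and `∂x̃`. An isometry compatible with `R` preserves this flag and is
therefore triangular. -/
theorem exists_frame {P Q : Fin 3 → ℝ} (hP : (P 0, P 1) ∈ O) (hQ : (Q 0, Q 1) ∈ O)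
    (hne : dY (dY f) (Q 0) (Q 1) ≠ 0) (Φ : (Fin 3 → ℝ) ≃ₗ[ℝ] (Fin 3 → ℝ)) {lam : ℝ}
    (hlam : lam ≠ 0)
    (hg : ∀ u v, (walker O hO f hf).innerAt Q (Φ u) (Φ v) = (walker O hO f hf).innerAt P u v)
    (h0 : ∀ v : Fin 4 → Fin 3 → ℝ, (walker O hO f hf).nablaRAt 0 Q (fun s => Φ (v s))
      = (lam ^ 2)⁻¹ * (walker O hO f hf).nablaRAt 0 P v) :
    ∃ a b c σ d e : ℝ, a ≠ 0 ∧ σ ^ 2 = 1 ∧ Φ ![1, 0, 0] = ![a, b, c] ∧ Φ ![0, 1, 0] = ![0, σ, d] ∧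
      Φ ![0, 0, 1] = ![0, 0, e] ∧
      a ^ 2 * lam ^ 2 * dY (dY f) (Q 0) (Q 1) = dY (dY f) (P 0) (P 1) := by
  -- On `(u, w, u, w)` the curvature is `-h` times a squared area; as `h(Q) ≠ 0`, it detects when
  -- the area vanishes.
  have h0' : ∀ u w, area (Φ u) (Φ w) ^ 2 * dY (dY f) (Q 0) (Q 1)
      = (lam ^ 2)⁻¹ * (area u w ^ 2 * dY (dY f) (P 0) (P 1)) := by
    intro u w
    have := h0 ![u, w, u, w]
    rw [walker_nablaRAt_zero hQ, walker_nablaRAt_zero hP] at this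
    simp at this
    linear_combination this
  have h2 : ∀ u, area u (Φ ![0, 0, 1]) = 0 := by
    intro u
    have := h0' (Φ.symm u) ![0, 0, 1]
    simpa [area, hne] using this
  have e0 := h2 ![1, 0, 0]
  have e1 := h2 ![0, 1, 0]
  simp [area] at e0 e1
  have g02 := hg ![1, 0, 0] ![0, 0, 1]
  have g12 := hg ![0, 1, 0] ![0, 0, 1]
  have g11 := hg ![0, 1, 0] ![0, 1, 0]
  simp only [walker_innerAt, e0, e1] at g02 g12 g11
  simp at g02 g12 g11
  have hz : Φ ![0, 0, 1] 2 ≠ 0 := by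
    intro h
    simp [h] at g02
  have ha : Φ ![1, 0, 0] 0 ≠ 0 := by
    intro h
    simp [h] at g02
  have hy0 : Φ ![0, 1, 0] 0 = 0 := by
    rcases g12 with h | h
    · exact h
    · exact absurd h hz
  have hσ : Φ ![0, 1, 0] 1 ^ 2 = 1 := by
    rw [hy0] at g11
    linear_combination g11
  refine ⟨Φ ![1, 0, 0] 0, Φ ![1, 0, 0] 1, Φ ![1, 0, 0] 2, Φ ![0, 1, 0] 1, Φ ![0, 1, 0] 2,
    Φ ![0, 0, 1] 2, ha, hσ, ?_, ?_, ?_, ?_⟩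
  · ext i
    fin_cases i <;> simp
  · ext i
    fin_cases i <;> simp [hy0]
  · ext i
    fin_cases i <;> simp [e0, e1]
  · have h3 := h0' ![1, 0, 0] ![0, 1, 0]
    simp [area, hy0] at h3
    field_simp at h3
    rw [← h3]
    linear_combination (- Φ ![1, 0, 0] 0 ^ 2 * lam ^ 2 * dY (dY f) (Q 0) (Q 1)) * hσ

theorem PseudoRiemannianDomain.IsHomothetyCurvatureHomogeneous.jetRelation
    (h : (walker O hO f hf).IsHomothetyCurvatureHomogeneous 1) {P Q : ℝ × ℝ} (hP : P ∈ O)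
    (hQ : Q ∈ O) (hne : dY (dY f) Q.1 Q.2 ≠ 0) :
    ∃ lam a b σ, JetRelation (dY (dY f)) P Q lam a b σ := by
  -- Nothing depends on `x̃`, so the points with `x̃ = 0` suffice.
  obtain ⟨Φ, lam, hlam, hg, hR⟩ := h ![P.1, P.2, 0] hP ![Q.1, Q.2, 0] hQ
  obtain ⟨a, b, c, σ, d, e, ha, hσ, hx, hy, hz, hh⟩ := exists_frame (hf := hf) (P := ![P.1, P.2, 0])
    (Q := ![Q.1, Q.2, 0]) hP hQ hne Φ hlam hg (hR 0 (by norm_num))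
  -- With `∂x, ∂y, ∂x, ∂y` in the first four slots the area factor at `Q` is `(aσ)²`, which leaves
  -- `dh(Φ w)`.
  have h1 : ∀ w : Fin 3 → ℝ, _ := fun w =>
    hR 1 le_rfl ![![1, 0, 0], ![0, 1, 0], ![1, 0, 0], ![0, 1, 0], w]
  have hPc : ((![P.1, P.2, 0] : Fin 3 → ℝ) 0, (![P.1, P.2, 0] : Fin 3 → ℝ) 1) ∈ O := hP
  have hQc : ((![Q.1, Q.2, 0] : Fin 3 → ℝ) 0, (![Q.1, Q.2, 0] : Fin 3 → ℝ) 1) ∈ O := hQ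
  simp only [walker_nablaRAt_one hPc, walker_nablaRAt_one hQc] at h1
  have hx1 := h1 ![1, 0, 0]
  have hy1 := h1 ![0, 1, 0]
  simp [hx, hy, area] at hx1 hy1
  refine ⟨lam, a, b, σ, hlam, ha, hσ, hh, ?_, ?_⟩
  · field_simp at hx1
    linear_combination (-1 : ℝ) * hx1 - (a ^ 2 * lam ^ 3 *
      (a * dX (dY (dY f)) Q.1 Q.2 + b * dY (dY (dY f)) Q.1 Q.2)) * hσ
  · field_simp at hy1
    linear_combination hy1 - (a ^ 2 * lam ^ 3 * σ * dY (dY (dY f)) Q.1 Q.2) * hσ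

theorem PseudoRiemannianDomain.IsHomothetyCurvatureHomogeneous.jetRelationTwo
    (h : (walker O hO f hf).IsHomothetyCurvatureHomogeneous 2) {P Q : ℝ × ℝ} (hP : P ∈ O)
    (hQ : Q ∈ O) (hne : dY (dY f) Q.1 Q.2 ≠ 0) :
    ∃ lam a b σ, JetRelationTwo f (dY (dY f)) P Q lam a b σ := by
  obtain ⟨Φ, lam, hlam, hg, hR⟩ := h ![P.1, P.2, 0] hP ![Q.1, Q.2, 0] hQ
  obtain ⟨a, b, c, σ, d, e, ha, hσ, hx, hy, hz, hh⟩ := exists_frame (hf := hf) (P := ![P.1, P.2, 0])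
    (Q := ![Q.1, Q.2, 0]) hP hQ hne Φ hlam hg (hR 0 (by norm_num))
  have h1 : ∀ w : Fin 3 → ℝ, _ := fun w =>
    hR 1 (by norm_num) ![![1, 0, 0], ![0, 1, 0], ![1, 0, 0], ![0, 1, 0], w]
  have h2 : ∀ w z : Fin 3 → ℝ, _ := fun w z =>
    hR 2 le_rfl ![![1, 0, 0], ![0, 1, 0], ![1, 0, 0], ![0, 1, 0], w, z]
  have hPc : ((![P.1, P.2, 0] : Fin 3 → ℝ) 0, (![P.1, P.2, 0] : Fin 3 → ℝ) 1) ∈ O := hP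
  have hQc : ((![Q.1, Q.2, 0] : Fin 3 → ℝ) 0, (![Q.1, Q.2, 0] : Fin 3 → ℝ) 1) ∈ O := hQ
  simp only [walker_nablaRAt_one hPc, walker_nablaRAt_one hQc] at h1
  simp only [walker_nablaRAt_two hPc, walker_nablaRAt_two hQc] at h2
  have hx1 := h1 ![1, 0, 0]
  have hy1 := h1 ![0, 1, 0]
  have hxx := h2 ![1, 0, 0] ![1, 0, 0]
  have hxy := h2 ![1, 0, 0] ![0, 1, 0]
  have hyy := h2 ![0, 1, 0] ![0, 1, 0]
  simp [hx, hy, area] at hx1 hy1 hxx hxy hyy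
  field_simp at hx1 hy1 hxx hxy hyy
  refine ⟨lam, a, b, σ, ⟨hlam, ha, hσ, hh, ?_, ?_⟩, ?_, ?_, ?_⟩
  · linear_combination (-1 : ℝ) * hx1 - (a ^ 2 * lam ^ 3 *
      (a * dX (dY (dY f)) Q.1 Q.2 + b * dY (dY (dY f)) Q.1 Q.2)) * hσ
  · linear_combination hy1 - (a ^ 2 * lam ^ 3 * σ * dY (dY (dY f)) Q.1 Q.2) * hσ
  · linear_combination (-1 : ℝ) * hxx - (a ^ 2 * lam ^ 4 * (a ^ 2 *
      (dX (dX (dY (dY f))) Q.1 Q.2 - dY f Q.1 Q.2 * dY (dY (dY f)) Q.1 Q.2)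
      + 2 * a * b * dY (dX (dY (dY f))) Q.1 Q.2 + b ^ 2 * dY (dY (dY (dY f))) Q.1 Q.2)) * hσ
  · linear_combination (-1 : ℝ) * hxy - (a ^ 2 * lam ^ 4 * σ *
      (a * dY (dX (dY (dY f))) Q.1 Q.2 + b * dY (dY (dY (dY f))) Q.1 Q.2)) * hσ
  · linear_combination hyy
      - (a ^ 2 * lam ^ 4 * dY (dY (dY (dY f))) Q.1 Q.2) * (σ ^ 2 + 1) * hσ

/-- The linear map given by a lower triangular matrix with non-zero diagonal. -/
def triangularEquiv (a b c σ d : ℝ) (ha : a ≠ 0) (hσ : σ ^ 2 = 1) :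
    (Fin 3 → ℝ) ≃ₗ[ℝ] (Fin 3 → ℝ) :=
  LinearEquiv.ofInjectiveEndo
    (Matrix.toLin' !![a, 0, 0; b, σ, 0; c, d, a⁻¹]) <| by
      have hσ0 : σ ≠ 0 := by
        rintro rfl
        norm_num at hσ
      rw [← LinearMap.ker_eq_bot, LinearMap.ker_eq_bot']
      intro v hv
      have h0 := congrFun hv 0
      have h1 := congrFun hv 1
      have h2 := congrFun hv 2
      simp [Matrix.mulVec, dotProduct, Fin.sum_univ_three, ha] at h0 h1 h2
      simp [h0, hσ0] at h1
      simp [h0, h1, ha] at h2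
      ext i
      fin_cases i <;> simp [h0, h1, h2]

theorem triangularEquiv_apply (a b c σ d : ℝ) (ha : a ≠ 0) (hσ : σ ^ 2 = 1) (v : Fin 3 → ℝ) :
    triangularEquiv a b c σ d ha hσ v
      = ![a * v 0, b * v 0 + σ * v 1, c * v 0 + d * v 1 + a⁻¹ * v 2] := by
  rw [triangularEquiv, LinearEquiv.coe_ofInjectiveEndo]
  ext i
  fin_cases i <;> simp [Matrix.mulVec, dotProduct, Fin.sum_univ_three]

theorem isHomothetyCurvatureHomogeneous_one_of_jetRelation
    (h : ∀ P ∈ O, ∀ Q ∈ O, ∃ lam a b σ, JetRelation (dY (dY f)) P Q lam a b σ) :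
    (walker O hO f hf).IsHomothetyCurvatureHomogeneous 1 := by
  intro P hP Q hQ
  have hP' : (P 0, P 1) ∈ O := hP
  have hQ' : (Q 0, Q 1) ∈ O := hQ
  obtain ⟨lam, a, b, σ, hlam, ha, hσ, h0, hx, hy⟩ := h _ hP' _ hQ'
  -- The last row is forced by isometry: the `∂x̃` entry `a⁻¹` by `g(∂x, ∂x̃) = 1`, the others by
  -- `g(∂x, ∂x) = -2f` and `g(∂x, ∂y) = 0`.
  refine ⟨triangularEquiv a b ((-2 * f (P 0) (P 1) + 2 * f (Q 0) (Q 1) * a ^ 2 - b ^ 2) / (2 * a))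
    σ (-(b * σ) / a) ha hσ, lam, hlam, ?_, ?_⟩
  · intro u v
    simp only [walker_innerAt, triangularEquiv_apply]
    simp
    field_simp
    linear_combination (2 * u 1 * v 1) * hσ
  · intro ℓ hℓ v
    interval_cases ℓ
    · rw [walker_nablaRAt_zero hQ', walker_nablaRAt_zero hP']
      simp only [triangularEquiv_apply, area]
      simp at h0 ⊢
      rw [← h0]
      field_simp
      linear_combination (dY (dY f) (Q 0) (Q 1) * (v 0 0 * v 1 1 - v 0 1 * v 1 0)
        * (v 2 0 * v 3 1 - v 2 1 * v 3 0)) * hσ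
    · rw [walker_nablaRAt_one hQ', walker_nablaRAt_one hP']
      simp only [triangularEquiv_apply, area]
      simp at h0 hx hy ⊢
      rw [← hx, ← hy]
      field_simp
      linear_combination -((v 0 0 * v 1 1 - v 0 1 * v 1 0) * (v 2 0 * v 3 1 - v 2 1 * v 3 0)
        * (dY (dY (dY f)) (Q 0) (Q 1) * (b * v 4 0 + σ * v 4 1)
          + a * v 4 0 * dX (dY (dY f)) (Q 0) (Q 1))) * hσ

end Frames

/-! ### First-order homogeneity when `f_yyy` never vanishes. -/

theorem IsPreconnected.mul_pos_of_ne_zero {X : Type*} [TopologicalSpace X] {s : Set X}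
    (hs : IsPreconnected s) {g : X → ℝ} (hg : ContinuousOn g s) (h0 : ∀ x ∈ s, g x ≠ 0) {x y : X}
    (hx : x ∈ s) (hy : y ∈ s) : 0 < g x * g y := by
  by_contra hn
  have hn' : g x * g y ≤ 0 := not_lt.1 hn
  have hord := (hs.image g hg).ordConnected
  have : (0 : ℝ) ∈ g '' s := by
    rcases mul_nonpos_iff.1 hn' with h | h
    · exact hord.out ⟨y, hy, rfl⟩ ⟨x, hx, rfl⟩ ⟨h.2, h.1⟩
    · exact hord.out ⟨x, hx, rfl⟩ ⟨y, hy, rfl⟩ ⟨h.1, h.2⟩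
  obtain ⟨z, hz, hz0⟩ := this
  exact h0 z hz hz0

section CurvatureHomogeneous

variable {O : Set (ℝ × ℝ)} {hO : IsOpen O} {f : ℝ → ℝ → ℝ}
  {hf : ContDiffOn ℝ ∞ (Function.uncurry f) O}

theorem walker_isHomothetyCurvatureHomogeneous_one (hc : IsPreconnected O)
    (h2 : ∀ q ∈ O, dY (dY f) q.1 q.2 ≠ 0) (h3 : ∀ q ∈ O, dY (dY (dY f)) q.1 q.2 ≠ 0) :
    (walker O hO f hf).IsHomothetyCurvatureHomogeneous 1 := by
  have hf' : SmoothOn O f := hf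
  apply isHomothetyCurvatureHomogeneous_one_of_jetRelation
  intro P hP Q hQ
  have hpos : 0 < dY (dY f) P.1 P.2 * dY (dY f) Q.1 Q.2 :=
    hc.mul_pos_of_ne_zero (g := Function.uncurry (dY (dY f)))
      (ContDiffOn.continuousOn ((hf'.dY hO).dY hO)) h2 hP hQ
  have hP2 := h2 P hP
  have hQ2 := h2 Q hQ
  have hP3 := h3 P hP
  have hQ3 := h3 Q hQ
  generalize dY (dY f) = h at *
  have hr : 0 < h P.1 P.2 / h Q.1 Q.2 := by
    rw [div_eq_mul_inv, ← mul_pos_iff_of_pos_right (sq_pos_of_ne_zero hQ2)]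
    field_simp
    exact hpos
  -- Here `r` stands for `a * lam`. The order-zero relation gives `r² = h(P) / h(Q)`, the `y`
  -- relation with `σ = 1` then gives `lam`, and the `x` relation can be solved for `b` since
  -- `h_y(Q) ≠ 0`.
  set r := Real.sqrt (h P.1 P.2 / h Q.1 Q.2) with hr_def
  have hr2 : r ^ 2 = h P.1 P.2 / h Q.1 Q.2 := Real.sq_sqrt hr.le
  have hr0 : r ≠ 0 := (Real.sqrt_pos.2 hr).ne'
  set lam := dY h P.1 P.2 * h Q.1 Q.2 / (dY h Q.1 Q.2 * h P.1 P.2) with hlam_def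
  have hlam : lam ≠ 0 := by positivity
  have hr2' : r ^ 2 * h Q.1 Q.2 = h P.1 P.2 := by rw [hr2]; field_simp
  have hl' : h P.1 P.2 * lam * dY h Q.1 Q.2 = dY h P.1 P.2 * h Q.1 Q.2 := by
    rw [hlam_def]; field_simp
  refine ⟨lam, r / lam, (dX h P.1 P.2 / (r ^ 2 * lam) - r / lam * dX h Q.1 Q.2) / dY h Q.1 Q.2, 1,
    hlam, by positivity, by norm_num, ?_, ?_, ?_⟩
  · field_simp
    exact hr2'
  · field_simp
    ring
  · field_simp
    have : h Q.1 Q.2 * (r ^ 2 * lam * dY h Q.1 Q.2 - dY h P.1 P.2) = 0 := by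
      linear_combination hl' + lam * dY h Q.1 Q.2 * hr2'
    have := (mul_eq_zero.1 this).resolve_left hQ2
    linear_combination this

end CurvatureHomogeneous

/-! ### The case `f_yy = α(x)`: inverse squares. -/

section InverseSquare

variable {O : Set (ℝ × ℝ)} {hO : IsOpen O} {f : ℝ → ℝ → ℝ}
  {hf : ContDiffOn ℝ ∞ (Function.uncurry f) O}

/-- A function of `y` that is a quadratic polynomial near a point has the expected derivatives. -/
theorem dY_dY_of_quadratic (hO : IsOpen O) {A β γ : ℝ → ℝ}
    (h : ∀ q ∈ O, f q.1 q.2 = A q.1 * q.2 ^ 2 + β q.1 * q.2 + γ q.1) :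
    ∀ x y, (x, y) ∈ O → dY f x y = 2 * A x * y + β x ∧ dY (dY f) x y = 2 * A x := by
  have h1 : ∀ x y, (x, y) ∈ O → dY f x y = 2 * A x * y + β x := by
    intro x y hq
    rw [dY_congr hO (χ := fun x y => A x * y ^ 2 + β x * y + γ x) (fun x y hq => h (x, y) hq) hq]
    refine HasDerivAt.deriv ?_
    convert (((hasDerivAt_pow 2 y).const_mul (A x)).add ((hasDerivAt_id y).const_mul (β x))).add_const
      (γ x) using 1
    simp
    ring
  refine fun x y hq => ⟨h1 x y hq, ?_⟩
  rw [dY_congr hO (χ := fun x y => 2 * A x * y + β x) h1 hq]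
  refine HasDerivAt.deriv ?_
  simpa using ((hasDerivAt_id y).const_mul (2 * A x)).add_const (β x)

theorem jetRelation_of_isInverseSquareQuadratic (hO : IsOpen O) (h : IsInverseSquareQuadratic O f)
    {P Q : ℝ × ℝ} (hP : P ∈ O) (hQ : Q ∈ O) :
    ∃ lam a b σ, JetRelation (dY (dY f)) P Q lam a b σ := by
  obtain ⟨a, x₀, β, γ, ha, -, -, h⟩ := h
  have h2 : ∀ x y, (x, y) ∈ O → dY (dY f) x y = 2 * (a * ((x - x₀) ^ 2)⁻¹) := fun x y hq =>
    (dY_dY_of_quadratic hO (A := fun x => a * ((x - x₀) ^ 2)⁻¹) (fun q hq => (h q hq).2) x y hq).2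
  have hne : ∀ x y, (x, y) ∈ O → x - x₀ ≠ 0 := fun x y hq => sub_ne_zero.2 (h (x, y) hq).1
  have hx : ∀ x y, (x, y) ∈ O → dX (dY (dY f)) x y = -4 * a * ((x - x₀) ^ 3)⁻¹ := by
    intro x y hq
    rw [dX_congr hO h2 hq]
    refine HasDerivAt.deriv ?_
    have h0 := hne x y hq
    have hd := (((((hasDerivAt_id x).sub_const x₀).fun_pow 2).fun_inv
      (pow_ne_zero 2 h0)).const_mul a).const_mul 2
    refine hd.congr_deriv ?_
    simp only [id]
    field_simp
    ring
  have hy : ∀ x y, (x, y) ∈ O → dY (dY (dY f)) x y = 0 := by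
    intro x y hq
    rw [dY_congr hO h2 hq, dY, deriv_const]
  have hP0 := hne P.1 P.2 hP
  have hQ0 := hne Q.1 Q.2 hQ
  -- The factor `a` is that of the dilation about `x₀` which takes the `x`-coordinate of `P` to that
  -- of `Q`. Since `h_y = 0`, the choice of `b` is immaterial.
  refine ⟨1, (Q.1 - x₀) / (P.1 - x₀), 0, 1, one_ne_zero, div_ne_zero hQ0 hP0, one_pow 2, ?_, ?_, ?_⟩
  · rw [h2 _ _ hP, h2 _ _ hQ]
    field_simp
  · rw [hx _ _ hP, hx _ _ hQ, hy _ _ hQ]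
    field_simp
    ring
  · rw [hy _ _ hP, hy _ _ hQ]
    ring

/-- A non-vanishing solution of `(α')² = c α³` with non-vanishing derivative is a multiple of an
inverse square. -/
theorem exists_eq_inv_sq {I : Set ℝ} (hI : IsOpen I) (hc : IsPreconnected I) (hne : I.Nonempty)
    {α : ℝ → ℝ} (hα : ContDiffOn ℝ ∞ α I) (h0 : ∀ x ∈ I, α x ≠ 0) (h1 : ∀ x ∈ I, deriv α x ≠ 0)
    {c : ℝ} (h : ∀ x ∈ I, deriv α x ^ 2 = c * α x ^ 3) :
    ∃ a x₀ : ℝ, a ≠ 0 ∧ ∀ x ∈ I, x ≠ x₀ ∧ α x = 2 * (a * ((x - x₀) ^ 2)⁻¹) := by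
  obtain ⟨z, hz⟩ := hne
  have hd : ∀ x ∈ I, HasDerivAt α (deriv α x) x := fun x hx =>
    ((hα.contDiffAt (hI.mem_nhds hx)).differentiableAt (by simp)).hasDerivAt
  have hd' : ContDiffOn ℝ ∞ (deriv α) I := hα.deriv_of_isOpen hI (by simp)
  have hdd : ∀ x ∈ I, HasDerivAt (deriv α) (deriv (deriv α) x) x := fun x hx =>
    ((hd'.contDiffAt (hI.mem_nhds hx)).differentiableAt (by simp)).hasDerivAt
  -- The equation is differentiated and the non-zero factor `α'` cancelled.
  have hr : ∀ x ∈ I, 2 * deriv (deriv α) x = 3 * c * α x ^ 2 := by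
    intro x hx
    have e1 := (hdd x hx).pow 2
    have e2 := ((hd x hx).pow 3).const_mul c
    have e3 : deriv α ^ 2 =ᶠ[nhds x] fun y => c * (α ^ 3) y := by
      filter_upwards [hI.mem_nhds hx] with y hy using h y hy
    have e4 := (e2.congr_of_eventuallyEq e3).unique e1
    simp at e4
    have : deriv α x * (2 * deriv (deriv α) x - 3 * c * α x ^ 2) = 0 := by linear_combination -e4
    have := (mul_eq_zero.1 this).resolve_left (h1 x hx)
    linear_combination this
  -- `2 α / α'` has derivative `-1`
  have hu : ∀ x ∈ I, HasDerivAt (fun x => 2 * (α x / deriv α x) + x) 0 x := by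
    intro x hx
    have hx1 := h1 x hx
    refine ((((hd x hx).div (hdd x hx) hx1).const_mul 2).add (hasDerivAt_id x)).congr_deriv ?_
    field_simp
    linear_combination -α x * hr x hx + 3 * h x hx
  set x₀ := 2 * (α z / deriv α z) + z with hx₀
  have hconst : ∀ x ∈ I, 2 * (α x / deriv α x) + x = x₀ := by
    intro x hx
    exact hI.is_const_of_deriv_eq_zero hc
      (fun y hy => (hu y hy).differentiableAt.differentiableWithinAt) (fun y hy => (hu y hy).deriv)
      hx hz
  have hc0 : c ≠ 0 := by
    rintro rfl
    have := h z hz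
    simp [h1 z hz] at this
  -- From `x - x₀ = -2α / α'` and `α'² = c α³` follows `(x - x₀)² = 4 / (c α)`, hence the constant
  -- `2 / c`.
  refine ⟨2 / c, x₀, by positivity, fun x hx => ?_⟩
  have hx0 := h0 x hx
  have hx1 := h1 x hx
  have e : x - x₀ = -2 * α x / deriv α x := by linear_combination (hconst x hx)
  have hne : x - x₀ ≠ 0 := by
    rw [e]
    positivity
  refine ⟨sub_ne_zero.1 hne, ?_⟩
  rw [e]
  field_simp
  linear_combination -h x hx


theorem isInverseSquareQuadratic_of_jetRelation (hO : IsOpen O) (hc : IsConnected O)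
    (hf : SmoothOn O f) (hslice : ∀ x : ℝ, IsPreconnected {y : ℝ | (x, y) ∈ O}) {α : ℝ → ℝ}
    (h0 : ∀ q ∈ O, dY (dY f) q.1 q.2 ≠ 0)
    (hα : ∀ q ∈ O, dY (dY f) q.1 q.2 = α q.1) (h1 : ∀ q ∈ O, deriv α q.1 ≠ 0)
    (h : ∀ P ∈ O, ∀ Q ∈ O, ∃ lam a b σ, JetRelation (dY (dY f)) P Q lam a b σ) :
    IsInverseSquareQuadratic O f := by
  set I := Prod.fst '' O with hI_def
  have hI : IsOpen I := isOpenMap_fst O hO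
  have hIc : IsPreconnected I := hc.isPreconnected.image _ continuous_fst.continuousOn
  have hyx : ∀ x ∈ I, ∃ y, (x, y) ∈ O := by
    rintro x ⟨⟨x', y⟩, hq, rfl⟩
    exact ⟨y, hq⟩
  have hev : ∀ {x y}, (x, y) ∈ O → ∀ᶠ t in nhds x, (t, y) ∈ O := by
    intro x y hq
    have : ContinuousAt (fun t : ℝ => (t, y)) x := by fun_prop
    exact this (hO.mem_nhds hq)
  have hsm : ∀ {φ : ℝ → ℝ → ℝ} {x y}, SmoothOn O φ → (x, y) ∈ O →
      ContDiffAt ℝ ∞ (fun t => φ t y) x := by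
    intro φ x y hφ hq
    exact (ContDiffOn.contDiffAt hφ (hO.mem_nhds hq)).comp (f := fun t : ℝ => (t, y)) x
      (by fun_prop)
  have hh := (hf.dY hO).dY hO
  have hαs : ContDiffOn ℝ ∞ α I := by
    intro x hx
    obtain ⟨y, hq⟩ := hyx x hx
    refine ((hsm hh hq).congr_of_eventuallyEq ?_).contDiffWithinAt
    filter_upwards [hev hq] with t ht using (hα (t, y) ht).symm
  have hαx : ∀ x y, (x, y) ∈ O → dX (dY (dY f)) x y = deriv α x := by
    intro x y hq
    rw [dX_congr hO (χ := fun x _ => α x) (fun x y hq => hα (x, y) hq) hq]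
    rfl
  have hαy : ∀ x y, (x, y) ∈ O → dY (dY (dY f)) x y = 0 := by
    intro x y hq
    rw [dY_congr hO (χ := fun x _ => α x) (fun x y hq => hα (x, y) hq) hq]
    simp [dY]
  have hα0 : ∀ x ∈ I, α x ≠ 0 := by
    intro x hx
    obtain ⟨y, hq⟩ := hyx x hx
    exact hα (x, y) hq ▸ h0 (x, y) hq
  have hα1 : ∀ x ∈ I, deriv α x ≠ 0 := by
    intro x hx
    obtain ⟨y, hq⟩ := hyx x hx
    exact h1 (x, y) hq
  obtain ⟨z, hz⟩ := hc.nonempty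
  have hzI : z.1 ∈ I := ⟨z, hz, rfl⟩
  -- With `h_y = 0` the relations multiply `α` by `(a lam)²` and `α'` by `(a lam)³`, so `α'² / α³`
  -- is the same at all points.
  obtain ⟨a, x₀, ha, hax⟩ := exists_eq_inv_sq hI hIc ⟨z.1, hzI⟩ hαs hα0 hα1
    (c := deriv α z.1 ^ 2 / α z.1 ^ 3) (by
      intro x hx
      obtain ⟨y, hq⟩ := hyx x hx
      obtain ⟨lam, a, b, σ, hlam, ha, -, e0, e1, -⟩ := h (x, y) hq z hz
      have hz0 := hα0 z.1 hzI
      have hz1 := hα1 z.1 hzI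
      rw [hα z hz, hα _ hq] at e0
      rw [hαx _ _ hz, hαy _ _ hz, hαx _ _ hq] at e1
      rw [← e0, ← e1]
      field_simp
      ring)
  -- Two integrations in `y`; connectedness of the slice makes each constant of integration depend
  -- on `x` alone.
  have hβ : ∀ x ∈ I, ∃ β γ : ℝ, (∀ y, (x, y) ∈ O → dY f x y - α x * y = β) ∧
      ∀ y, (x, y) ∈ O → f x y - α x / 2 * y ^ 2 - β * y = γ := by
    intro x hx
    obtain ⟨y₀, hq₀⟩ := hyx x hx
    have hSo : IsOpen {y : ℝ | (x, y) ∈ O} := hO.preimage (by fun_prop)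
    have key : ∀ g : ℝ → ℝ, (∀ y, (x, y) ∈ O → HasDerivAt g 0 y) →
        ∀ y, (x, y) ∈ O → g y = g y₀ := fun g hg y hq =>
      hSo.is_const_of_deriv_eq_zero (hslice x)
        (fun y hy => (hg y hy).differentiableAt.differentiableWithinAt) (fun y hy => (hg y hy).deriv)
        hq hq₀
    have k1 := key (fun y => dY f x y - α x * y) (by
      intro y hq
      refine (((hf.dY hO).hasDerivAt_dY hO hq).sub ((hasDerivAt_id y).const_mul _)).congr_deriv ?_
      rw [hα (x, y) hq]
      simp)
    refine ⟨dY f x y₀ - α x * y₀, _, k1, key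
      (fun y => f x y - α x / 2 * y ^ 2 - (dY f x y₀ - α x * y₀) * y) ?_⟩
    intro y hq
    refine (((hf.hasDerivAt_dY hO hq).sub ((hasDerivAt_pow 2 y).const_mul _)).sub
      ((hasDerivAt_id y).const_mul _)).congr_deriv ?_
    have := k1 y hq
    norm_num
    linear_combination this
  choose! β γ hβ hγ using hβ
  refine ⟨a, x₀, β, γ, ha, ?_, ?_, ?_⟩
  · intro x hx
    obtain ⟨y, hq⟩ := hyx x hx
    refine ContDiffAt.contDiffWithinAt ?_
    -- Near `x` the function `β` can be computed along a fixed height `y`, where the formula is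
    -- smooth.
    have h3 : ContDiffAt ℝ ∞ (fun t => dY f t y - α t * y) x :=
      (hsm (hf.dY hO) hq).sub ((hαs.contDiffAt (hI.mem_nhds hx)).mul contDiffAt_const)
    refine h3.congr_of_eventuallyEq ?_
    filter_upwards [hev hq] with t ht using (hβ t ⟨_, ht, rfl⟩ y ht).symm
  · intro x hx
    obtain ⟨y, hq⟩ := hyx x hx
    refine ContDiffAt.contDiffWithinAt ?_
    have hat := hαs.contDiffAt (hI.mem_nhds hx)
    have h3 : ContDiffAt ℝ ∞ (fun t => f t y - α t / 2 * y ^ 2 - (dY f t y - α t * y) * y) x :=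
      ((hsm hf hq).sub ((hat.div_const 2).mul contDiffAt_const)).sub
        (((hsm (hf.dY hO) hq).sub (hat.mul contDiffAt_const)).mul contDiffAt_const)
    refine h3.congr_of_eventuallyEq ?_
    filter_upwards [hev hq] with t ht
    rw [hβ t ⟨_, ht, rfl⟩ y ht, hγ t ⟨_, ht, rfl⟩ y ht]
  · rintro ⟨x, y⟩ hq
    have hx : x ∈ I := ⟨_, hq, rfl⟩
    obtain ⟨e1, e2⟩ := hax x hx
    refine ⟨e1, ?_⟩
    change f x y = a * ((x - x₀) ^ 2)⁻¹ * y ^ 2 + β x * y + γ x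
    linear_combination hγ x hx y hq + y ^ 2 / 2 * e2

end InverseSquare

/-! ### Homotheties that preserve the fibration over the `x`-axis. -/

section Homothety

variable {O : Set (ℝ × ℝ)} {hO : IsOpen O} {f : ℝ → ℝ → ℝ}
  {hf : ContDiffOn ℝ ∞ (Function.uncurry f) O}
  {O' : Set (ℝ × ℝ)} {hO' : IsOpen O'} {F : ℝ → ℝ → ℝ}
  {hF : ContDiffOn ℝ ∞ (Function.uncurry F) O'}

/-- The map `(x, y, z) ↦ (μ x + x₁, l y + φ(x), (l²/μ) z - (l/μ) φ'(x) y + ψ(x))`. -/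
def fibreMap (l μ x₁ : ℝ) (φ φ₁ ψ : ℝ → ℝ) (p : Fin 3 → ℝ) : Fin 3 → ℝ :=
  ![μ * p 0 + x₁, l * p 1 + φ (p 0), l ^ 2 / μ * p 2 - l / μ * φ₁ (p 0) * p 1 + ψ (p 0)]

/-- The inverse of `fibreMap`. -/
def fibreMapInv (l μ x₁ : ℝ) (φ φ₁ ψ : ℝ → ℝ) (p : Fin 3 → ℝ) : Fin 3 → ℝ :=
  let x := (p 0 - x₁) / μ
  let y := (p 1 - φ x) / l
  ![x, y, μ / l ^ 2 * (p 2 + l / μ * φ₁ x * y - ψ x)]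

theorem fibreMapInv_fibreMap {l μ x₁ : ℝ} (hl : l ≠ 0) (hμ : μ ≠ 0) (φ φ₁ ψ : ℝ → ℝ)
    (p : Fin 3 → ℝ) :
    fibreMapInv l μ x₁ φ φ₁ ψ (fibreMap l μ x₁ φ φ₁ ψ p) = p := by
  ext i
  fin_cases i
  · simp [fibreMapInv, fibreMap, hμ]
  · simp [fibreMapInv, fibreMap, hμ, hl]
  · simp only [fibreMapInv, fibreMap]
    simp
    field_simp
    ring

theorem fibreMap_fibreMapInv {l μ x₁ : ℝ} (hl : l ≠ 0) (hμ : μ ≠ 0) (φ φ₁ ψ : ℝ → ℝ)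
    (p : Fin 3 → ℝ) :
    fibreMap l μ x₁ φ φ₁ ψ (fibreMapInv l μ x₁ φ φ₁ ψ p) = p := by
  ext i
  fin_cases i
  · simp [fibreMapInv, fibreMap]
    field_simp
    ring
  · simp [fibreMapInv, fibreMap]
    field_simp
    ring
  · simp [fibreMapInv, fibreMap]
    field_simp
    ring

theorem hasFDerivAt_fibreMap_apply {l μ x₁ : ℝ} {φ φ₁ ψ : ℝ → ℝ} {p : Fin 3 → ℝ} {φ₂ ψ₁ : ℝ}
    (hφ : HasDerivAt φ (φ₁ (p 0)) (p 0)) (hφ₁ : HasDerivAt φ₁ φ₂ (p 0))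
    (hψ : HasDerivAt ψ ψ₁ (p 0)) (u : Fin 3 → ℝ) :
    fderiv ℝ (fibreMap l μ x₁ φ φ₁ ψ) p u
      = ![μ * u 0, l * u 1 + φ₁ (p 0) * u 0,
        l ^ 2 / μ * u 2 - l / μ * (φ₂ * u 0 * p 1 + φ₁ (p 0) * u 1) + ψ₁ * u 0] := by
  have h0 := hasFDerivAt_apply (𝕜 := ℝ) (F' := fun _ : Fin 3 => ℝ) 0 p
  have h1 := hasFDerivAt_apply (𝕜 := ℝ) (F' := fun _ : Fin 3 => ℝ) 1 p
  have h2 := hasFDerivAt_apply (𝕜 := ℝ) (F' := fun _ : Fin 3 => ℝ) 2 p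
  have k : HasFDerivAt (fibreMap l μ x₁ φ φ₁ ψ) (ContinuousLinearMap.pi
      ![μ • ContinuousLinearMap.proj (R := ℝ) (φ := fun _ : Fin 3 => ℝ) 0,
        l • ContinuousLinearMap.proj (R := ℝ) (φ := fun _ : Fin 3 => ℝ) 1
          + φ₁ (p 0) • ContinuousLinearMap.proj (R := ℝ) (φ := fun _ : Fin 3 => ℝ) 0,
        (l ^ 2 / μ) • ContinuousLinearMap.proj (R := ℝ) (φ := fun _ : Fin 3 => ℝ) 2
          - ((l / μ * φ₁ (p 0)) • ContinuousLinearMap.proj (R := ℝ) (φ := fun _ : Fin 3 => ℝ) 1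
            + p 1 • (l / μ) • φ₂ • ContinuousLinearMap.proj (R := ℝ) (φ := fun _ : Fin 3 => ℝ) 0)
          + ψ₁ • ContinuousLinearMap.proj (R := ℝ) (φ := fun _ : Fin 3 => ℝ) 0]) p := by
    rw [hasFDerivAt_pi']
    intro i
    fin_cases i
    · exact (h0.const_mul μ).add_const x₁
    · exact (h1.const_mul l).add (hφ.comp_hasFDerivAt p h0)
    · exact ((h2.const_mul (l ^ 2 / μ)).sub
        (((hφ₁.comp_hasFDerivAt p h0).const_mul (l / μ)).mul h1)).add (hψ.comp_hasFDerivAt p h0)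
  rw [k.fderiv]
  ext i
  fin_cases i <;> simp
  ring

theorem contDiffOn_fibreMap {l μ x₁ : ℝ} {φ φ₁ ψ : ℝ → ℝ} {I : Set ℝ}
    (hφ : ContDiffOn ℝ ∞ φ I) (hφ₁ : ContDiffOn ℝ ∞ φ₁ I) (hψ : ContDiffOn ℝ ∞ ψ I) :
    ContDiffOn ℝ ∞ (fibreMap l μ x₁ φ φ₁ ψ) {p | p 0 ∈ I} := by
  have h0 : ∀ i : Fin 3, ContDiffOn ℝ ∞ (fun p : Fin 3 → ℝ => p i) {p | p 0 ∈ I} := fun i =>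
    (contDiff_apply ℝ ℝ i).contDiffOn
  have k : ∀ χ : ℝ → ℝ, ContDiffOn ℝ ∞ χ I →
      ContDiffOn ℝ ∞ (fun p : Fin 3 → ℝ => χ (p 0)) {p | p 0 ∈ I} := fun χ hχ =>
    hχ.comp (h0 0) fun p hp => hp
  rw [contDiffOn_pi]
  intro i
  fin_cases i
  · exact (contDiffOn_const.mul (h0 0)).add contDiffOn_const
  · exact (contDiffOn_const.mul (h0 1)).add (k φ hφ)
  · exact ((contDiffOn_const.mul (h0 2)).sub ((contDiffOn_const.mul (k _ hφ₁)).mul (h0 1))).add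
      (k _ hψ)

theorem contDiffOn_fibreMapInv {l μ x₁ : ℝ} {φ φ₁ ψ : ℝ → ℝ} {I : Set ℝ}
    (hφ : ContDiffOn ℝ ∞ φ I) (hφ₁ : ContDiffOn ℝ ∞ φ₁ I) (hψ : ContDiffOn ℝ ∞ ψ I) :
    ContDiffOn ℝ ∞ (fibreMapInv l μ x₁ φ φ₁ ψ) {p | (p 0 - x₁) / μ ∈ I} := by
  have h0 : ∀ i : Fin 3, ContDiffOn ℝ ∞ (fun p : Fin 3 → ℝ => p i) {p | (p 0 - x₁) / μ ∈ I} :=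
    fun i => (contDiff_apply ℝ ℝ i).contDiffOn
  have hx : ContDiffOn ℝ ∞ (fun p : Fin 3 → ℝ => (p 0 - x₁) / μ) {p | (p 0 - x₁) / μ ∈ I} :=
    ((h0 0).sub contDiffOn_const).div_const μ
  have k : ∀ χ : ℝ → ℝ, ContDiffOn ℝ ∞ χ I →
      ContDiffOn ℝ ∞ (fun p : Fin 3 → ℝ => χ ((p 0 - x₁) / μ)) {p | (p 0 - x₁) / μ ∈ I} :=
    fun χ hχ => hχ.comp hx fun p hp => hp
  have hy := ((h0 1).sub (k φ hφ)).div_const l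
  rw [contDiffOn_pi]
  intro i
  fin_cases i
  · exact hx
  · exact hy
  · exact contDiffOn_const.mul (((h0 2).add ((contDiffOn_const.mul (k _ hφ₁)).mul hy)).sub (k _ hψ))

/-- The homothety given by `fibreMap` over an open set `D` of the `(x, y)`-plane. -/
theorem exists_isLocalHomothety {l μ x₁ : ℝ} (hl : l ≠ 0) (hμ : μ ≠ 0) {φ φ₁ φ₂ ψ ψ₁ : ℝ → ℝ}
    {I : Set ℝ} (hI : IsOpen I) (hφ : ContDiffOn ℝ ∞ φ I) (hφ₁ : ContDiffOn ℝ ∞ φ₁ I)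
    (hψ : ContDiffOn ℝ ∞ ψ I) (hdφ : ∀ x ∈ I, HasDerivAt φ (φ₁ x) x)
    (hdφ₁ : ∀ x ∈ I, HasDerivAt φ₁ (φ₂ x) x) (hdψ : ∀ x ∈ I, HasDerivAt ψ (ψ₁ x) x)
    {D : Set (ℝ × ℝ)} (hD : IsOpen D) (hDO : D ⊆ O) (hDI : ∀ q ∈ D, q.1 ∈ I)
    (hDO' : ∀ q ∈ D, (μ * q.1 + x₁, l * q.2 + φ q.1) ∈ O')
    (hFf : ∀ q ∈ D, μ ^ 2 * F (μ * q.1 + x₁) (l * q.2 + φ q.1)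
      = l ^ 2 * f q.1 q.2 - l * φ₂ q.1 * q.2 + μ * ψ₁ q.1 + φ₁ q.1 ^ 2 / 2) :
    ∃ T, (walker O hO f hf).IsLocalHomothety (walker O' hO' F hF) (l ^ 2) T ∧
      T.source = {p | (p 0, p 1) ∈ D} ∧
      T.target = {p | ((p 0 - x₁) / μ, (p 1 - φ ((p 0 - x₁) / μ)) / l) ∈ D} ∧
      ∀ p, T p = fibreMap l μ x₁ φ φ₁ ψ p := by
  have hs : IsOpen {p : Fin 3 → ℝ | (p 0, p 1) ∈ D} := hD.preimage (by fun_prop)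
  have hci := contDiffOn_fibreMapInv (l := l) (μ := μ) (x₁ := x₁) hφ hφ₁ hψ
  have hts : {p : Fin 3 → ℝ | ((p 0 - x₁) / μ, (p 1 - φ ((p 0 - x₁) / μ)) / l) ∈ D}
      ⊆ {p | (p 0 - x₁) / μ ∈ I} := fun p hp => hDI _ hp
  have ht : IsOpen {p : Fin 3 → ℝ | ((p 0 - x₁) / μ, (p 1 - φ ((p 0 - x₁) / μ)) / l) ∈ D} := by
    have := hci.continuousOn.isOpen_inter_preimage (hI.preimage (by fun_prop)) hs
    have e : fibreMapInv l μ x₁ φ φ₁ ψ ⁻¹' {p | (p 0, p 1) ∈ D} ⊆ {p | (p 0 - x₁) / μ ∈ I} := hts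
    rwa [Set.inter_eq_right.2 e] at this
  have hc := (contDiffOn_fibreMap (l := l) (μ := μ) (x₁ := x₁) hφ hφ₁ hψ).mono
    (show {p : Fin 3 → ℝ | (p 0, p 1) ∈ D} ⊆ _ from fun p hp => hDI _ hp)
  have hci' := hci.mono hts
  let T : OpenPartialHomeomorph (Fin 3 → ℝ) (Fin 3 → ℝ) :=
    { toFun := fibreMap l μ x₁ φ φ₁ ψ
      invFun := fibreMapInv l μ x₁ φ φ₁ ψ
      source := {p | (p 0, p 1) ∈ D}
      target := {p | ((p 0 - x₁) / μ, (p 1 - φ ((p 0 - x₁) / μ)) / l) ∈ D}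
      map_source' := by
        intro p hp
        have := fibreMapInv_fibreMap (x₁ := x₁) hl hμ φ φ₁ ψ p
        have e0 := congrFun this 0
        have e1 := congrFun this 1
        simp only [Set.mem_ofPred_eq] at hp ⊢
        rw [← e0, ← e1] at hp
        exact hp
      map_target' := fun p hp => hp
      left_inv' := fun p _ => fibreMapInv_fibreMap hl hμ φ φ₁ ψ p
      right_inv' := fun p _ => fibreMap_fibreMapInv hl hμ φ φ₁ ψ p
      open_source := hs
      open_target := ht
      continuousOn_toFun := hc.continuousOn
      continuousOn_invFun := hci'.continuousOn }
  refine ⟨T, ⟨fun p hp => hDO hp, ?_, hc, hci', ?_⟩, rfl, rfl, fun p => rfl⟩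
  · intro p hp
    have := hDO' _ hp
    have e := fibreMap_fibreMapInv (x₁ := x₁) hl hμ φ φ₁ ψ p
    have e0 : μ * ((p 0 - x₁) / μ) + x₁ = p 0 := congrFun e 0
    have e1 : l * ((p 1 - φ ((p 0 - x₁) / μ)) / l) + φ ((p 0 - x₁) / μ) = p 1 := congrFun e 1
    simp only [e0, e1] at this
    exact this
  · intro p hp u v
    change (walker O' hO' F hF).innerAt (fibreMap l μ x₁ φ φ₁ ψ p)
      (fderiv ℝ (fibreMap l μ x₁ φ φ₁ ψ) p u) (fderiv ℝ (fibreMap l μ x₁ φ φ₁ ψ) p v) = _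
    have hp0 := hDI _ hp
    have key := hFf _ hp
    simp only [hasFDerivAt_fibreMap_apply (hdφ _ hp0) (hdφ₁ _ hp0) (hdψ _ hp0), walker_innerAt]
    simp [fibreMap] at key ⊢
    field_simp
    -- The term `-(l/μ) φ' y` of the third component cancels the `dx dy` part of `(l dy + φ' dx)²`.
    -- Only the `dx²` coefficients remain, and `key` compares them.
    linear_combination (-2 * u 0 * v 0) * key

end Homothety

/-! ### Smooth antiderivatives and a linear equation of second order. -/

theorem exists_contDiffOn_antiderivative {g : ℝ → ℝ} {x₀ r : ℝ}
    (hg : ContDiffOn ℝ ∞ g (Metric.ball x₀ r)) (hr : 0 < r) (c : ℝ) :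
    ∃ ψ : ℝ → ℝ, ContDiffOn ℝ ∞ ψ (Metric.ball x₀ r) ∧
      (∀ x ∈ Metric.ball x₀ r, HasDerivAt ψ (g x) x) ∧ ψ x₀ = c := by
  have hx₀ : x₀ ∈ Metric.ball x₀ r := Metric.mem_ball_self hr
  have hord : (Metric.ball x₀ r).OrdConnected := (convex_ball x₀ r).ordConnected
  have hd : ∀ x ∈ Metric.ball x₀ r, HasDerivAt (fun x => c + ∫ t in x₀..x, g t) (g x) x := by
    intro x hx
    refine HasDerivAt.const_add c ?_
    refine intervalIntegral.integral_hasDerivAt_right ?_ ?_ ?_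
    · exact (hg.continuousOn.mono (hord.uIcc_subset hx₀ hx)).intervalIntegrable
    · exact hg.continuousOn.stronglyMeasurableAtFilter Metric.isOpen_ball x hx
    · exact hg.continuousOn.continuousAt (Metric.isOpen_ball.mem_nhds hx)
  refine ⟨_, ?_, hd, by simp⟩
  rw [contDiffOn_infty_iff_deriv_of_isOpen Metric.isOpen_ball]
  exact ⟨fun x hx => (hd x hx).differentiableAt.differentiableWithinAt,
    hg.congr fun x hx => (hd x hx).deriv⟩

/-- Local solvability of the linear equation `φ'' = b - A φ` with smooth coefficients. -/
theorem exists_linear_ode_solution {A b : ℝ → ℝ} {I : Set ℝ} (hI : IsOpen I) {x₀ : ℝ} (hx₀ : x₀ ∈ I)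
    (hA : ContDiffOn ℝ ∞ A I) (hb : ContDiffOn ℝ ∞ b I) (c : ℝ) :
    ∃ (r : ℝ) (φ φ₁ : ℝ → ℝ), 0 < r ∧ Metric.ball x₀ r ⊆ I ∧
      ContDiffOn ℝ ∞ φ (Metric.ball x₀ r) ∧ ContDiffOn ℝ ∞ φ₁ (Metric.ball x₀ r) ∧
      (∀ x ∈ Metric.ball x₀ r, HasDerivAt φ (φ₁ x) x) ∧
      (∀ x ∈ Metric.ball x₀ r, HasDerivAt φ₁ (b x - A x * φ x) x) ∧ φ x₀ = c := by
  -- The equation as an autonomous system for `(x, φ, φ')`, to which local existence for `C¹` vector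
  -- fields applies.
  let v : ℝ × ℝ × ℝ → ℝ × ℝ × ℝ := fun s => (1, s.2.2, b s.1 - A s.1 * s.2.1)
  let U : Set (ℝ × ℝ × ℝ) := {s | s.1 ∈ I}
  have hU : IsOpen U := hI.preimage continuous_fst
  have hv : ContDiffOn ℝ ∞ v U := by
    have h1 : ∀ g : ℝ → ℝ, ContDiffOn ℝ ∞ g I → ContDiffOn ℝ ∞ (fun s : ℝ × ℝ × ℝ => g s.1) U :=
      fun g hg => hg.comp contDiffOn_fst fun s hs => hs
    have h2 : ContDiffOn ℝ ∞ (fun s : ℝ × ℝ × ℝ => s.2.1) U := (by fun_prop : ContDiff ℝ ∞ _).contDiffOn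
    have h3 : ContDiffOn ℝ ∞ (fun s : ℝ × ℝ × ℝ => s.2.2) U := (by fun_prop : ContDiff ℝ ∞ _).contDiffOn
    exact contDiffOn_const.prodMk (h3.prodMk ((h1 b hb).sub ((h1 A hA).mul h2)))
  have hv1 : ContDiffAt ℝ 1 v (x₀, c, 0) :=
    (hv.contDiffAt (hU.mem_nhds hx₀)).of_le (by exact_mod_cast le_top)
  obtain ⟨α, hα0, ε, hε, hα⟩ :=
    hv1.exists_forall_mem_closedBall_exists_eq_forall_mem_Ioo_hasDerivAt₀ x₀
  obtain ⟨δ, hδ, hδI⟩ := Metric.isOpen_iff.1 hI x₀ hx₀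
  set r := min ε δ / 2 with hr_def
  have hr : 0 < r := by positivity
  have hrε : r < ε := by
    have := min_le_left ε δ
    have := lt_min hε hδ
    linarith
  have hrδ : r < δ := by
    have := min_le_right ε δ
    have := lt_min hε hδ
    linarith
  have hmem : ∀ t ∈ Set.Icc (x₀ - r) (x₀ + r), t ∈ Set.Ioo (x₀ - ε) (x₀ + ε) := by
    intro t ht
    exact ⟨by linarith [ht.1], by linarith [ht.2]⟩
  -- The first component has derivative `1` and starts at `x₀`, so it is the time; solutions thus
  -- stay over `I`.
  have htime : ∀ t ∈ Set.Ioo (x₀ - ε) (x₀ + ε), (α t).1 = t := by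
    have hd : ∀ t ∈ Set.Ioo (x₀ - ε) (x₀ + ε), HasDerivAt (fun t => (α t).1 - t) 0 t := by
      intro t ht
      have h1 : HasDerivAt (fun t => (α t).1) 1 t := (hα t ht).fst
      exact (h1.sub (hasDerivAt_id t)).congr_deriv (sub_self 1)
    intro t ht
    have := isOpen_Ioo.is_const_of_deriv_eq_zero isPreconnected_Ioo
      (fun y hy => (hd y hy).differentiableAt.differentiableWithinAt) (fun y hy => (hd y hy).deriv)
      ht (show x₀ ∈ Set.Ioo (x₀ - ε) (x₀ + ε) from ⟨by linarith, by linarith⟩)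
    simp only [hα0, sub_self] at this
    linarith
  have hIcc : ∀ t ∈ Set.Icc (x₀ - r) (x₀ + r), t ∈ I := by
    intro t ht
    refine hδI ?_
    rw [Metric.mem_ball, Real.dist_eq, abs_lt]
    exact ⟨by linarith [ht.1], by linarith [ht.2]⟩
  have hball : Metric.ball x₀ r ⊆ Set.Icc (x₀ - r) (x₀ + r) := by
    rw [← Real.closedBall_eq_Icc]
    exact Metric.ball_subset_closedBall
  -- The solution inherits the smoothness of the vector field.
  have hsm : ContDiffOn ℝ ∞ α (Set.Icc (x₀ - r) (x₀ + r)) := by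
    refine ODE.contDiffOn_enat_Icc_of_hasDerivWithinAt (f := fun _ => v) (u := U) (n := ⊤) ?_
      (fun t ht => (hα t (hmem t ht)).hasDerivWithinAt) ?_
    · exact hv.comp contDiffOn_snd fun s hs => hs.2
    · intro t ht
      change (α t).1 ∈ I
      rw [htime t (hmem t ht)]
      exact hIcc t ht
  have hsm' := hsm.mono hball
  refine ⟨r, fun t => (α t).2.1, fun t => (α t).2.2, hr, fun t ht => hIcc t (hball ht),
    contDiffOn_fst.comp (contDiffOn_snd.comp hsm' (Set.mapsTo_univ _ _)) (Set.mapsTo_univ _ _),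
    contDiffOn_snd.comp (contDiffOn_snd.comp hsm' (Set.mapsTo_univ _ _)) (Set.mapsTo_univ _ _),
    fun t ht => (hα t (hmem t (hball ht))).snd.fst, ?_, by simp [hα0]⟩
  intro t ht
  have := (hα t (hmem t (hball ht))).snd.snd
  simp only [v, htime t (hmem t (hball ht))] at this
  exact this

/-! ### Local isometries from matching `y`-derivatives. -/

section LocalIsometry

variable {O : Set (ℝ × ℝ)} {hO : IsOpen O} {f : ℝ → ℝ → ℝ}
  {hf : ContDiffOn ℝ ∞ (Function.uncurry f) O}
  {O' : Set (ℝ × ℝ)} {hO' : IsOpen O'} {F : ℝ → ℝ → ℝ}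
  {hF : ContDiffOn ℝ ∞ (Function.uncurry F) O'}

/-- A local isometry of Walker manifolds exists as soon as the `y`-derivatives of the defining
functions match. -/
theorem exists_local_isometry {σ μ x₁ : ℝ} (hσ : σ ^ 2 = 1) (hμ : μ ≠ 0) {φ φ₁ φ₂ : ℝ → ℝ}
    {I : Set ℝ} (hI : IsOpen I) (hφ : ContDiffOn ℝ ∞ φ I) (hφ₁ : ContDiffOn ℝ ∞ φ₁ I)
    (hφ₂ : ContDiffOn ℝ ∞ φ₂ I) (hdφ : ∀ x ∈ I, HasDerivAt φ (φ₁ x) x)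
    (hdφ₁ : ∀ x ∈ I, HasDerivAt φ₁ (φ₂ x) x) {D : Set (ℝ × ℝ)} (hD : IsOpen D) (hDO : D ⊆ O)
    {P : Fin 3 → ℝ} (hP : (P 0, P 1) ∈ D) (hPI : P 0 ∈ I)
    (hPO' : (μ * P 0 + x₁, σ * P 1 + φ (P 0)) ∈ O')
    (hFf : ∀ x y, (x, y) ∈ D → x ∈ I → (μ * x + x₁, σ * y + φ x) ∈ O' →
      μ ^ 2 * (σ * dY F (μ * x + x₁) (σ * y + φ x)) = dY f x y - σ * φ₂ x) (z : ℝ) :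
    ∃ T, (walker O hO f hf).IsLocalHomothety (walker O' hO' F hF) 1 T ∧ P ∈ T.source ∧
      T P = ![μ * P 0 + x₁, σ * P 1 + φ (P 0), z] := by
  have hf' : SmoothOn O f := hf
  have hF' : SmoothOn O' F := hF
  have hσ0 : σ ≠ 0 := by
    rintro rfl
    norm_num at hσ
  let m : ℝ × ℝ → ℝ × ℝ := fun q => (μ * q.1 + x₁, σ * q.2 + φ q.1)
  have hm : ContDiffOn ℝ ∞ m (Prod.fst ⁻¹' I) :=
    (ContDiff.contDiffOn (by fun_prop)).prodMk
      ((ContDiff.contDiffOn (by fun_prop)).add (hφ.comp contDiffOn_fst fun q hq => hq))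
  have hIo : IsOpen (Prod.fst ⁻¹' I : Set (ℝ × ℝ)) := hI.preimage continuous_fst
  have hD0 : IsOpen (D ∩ (Prod.fst ⁻¹' I ∩ m ⁻¹' O')) :=
    hD.inter (hm.continuousOn.isOpen_inter_preimage hIo hO')
  obtain ⟨r, hr, hball⟩ := Metric.isOpen_iff.1 hD0 (P 0, P 1) ⟨hP, hPI, hPO'⟩
  rw [← ball_prod_same] at hball
  set J := Metric.ball (P 0) r
  set K := Metric.ball (P 1) r
  have hJ0 : P 0 ∈ J := Metric.mem_ball_self hr
  have hK0 : P 1 ∈ K := Metric.mem_ball_self hr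
  have hJI : J ⊆ I := fun x hx => (hball (show (x, P 1) ∈ J ×ˢ K from ⟨hx, hK0⟩)).2.1
  have hk : ContDiffOn ℝ ∞ (fun x => (x, P 1)) J := ContDiff.contDiffOn (by fun_prop)
  have h1 : ContDiffOn ℝ ∞ (fun x => F (μ * x + x₁) (σ * P 1 + φ x)) J :=
    hF.comp ((hm.comp hk fun x hx => hJI hx)) fun x hx =>
      (hball (show (x, P 1) ∈ J ×ˢ K from ⟨hx, hK0⟩)).2.2
  have h2 : ContDiffOn ℝ ∞ (fun x => f x (P 1)) J :=
    hf.comp hk fun x hx => hDO (hball (show (x, P 1) ∈ J ×ˢ K from ⟨hx, hK0⟩)).1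
  -- This is the value of `ψ'` that the condition of `exists_isLocalHomothety` dictates along `y = P
  -- 1`. The constant of integration of `ψ` is then chosen so that `P` lands at height `z`.
  have h3 : ContDiffOn ℝ ∞ (fun x => (μ ^ 2 * F (μ * x + x₁) (σ * P 1 + φ x) - f x (P 1)
      + σ * φ₂ x * P 1 - φ₁ x ^ 2 / 2) / μ) J :=
    ((((contDiffOn_const.mul h1).sub h2).add
      ((contDiffOn_const.mul (hφ₂.mono hJI)).mul contDiffOn_const)).sub
      (((hφ₁.mono hJI).pow 2).div_const 2)).div_const μ
  obtain ⟨ψ, hψ, hdψ, hψ0⟩ := exists_contDiffOn_antiderivative h3 hr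
    (z - (σ ^ 2 / μ * P 2 - σ / μ * φ₁ (P 0) * P 1))
  obtain ⟨T, hT, hs, -, hTe⟩ := exists_isLocalHomothety (O := O) (hO := hO) (hf := hf)
    (hO' := hO') (hF := hF) (x₁ := x₁) hσ0 hμ Metric.isOpen_ball (hφ.mono hJI) (hφ₁.mono hJI) hψ
    (fun x hx => hdφ x (hJI hx)) (fun x hx => hdφ₁ x (hJI hx)) hdψ
    (D := J ×ˢ K) (Metric.isOpen_ball.prod Metric.isOpen_ball) (fun q hq => hDO (hball hq).1)
    (fun q hq => hq.1) (fun q hq => (hball hq).2.2) (by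
      rintro ⟨x, y⟩ ⟨hx, hy⟩
      change x ∈ J at hx
      change y ∈ K at hy
      -- The condition holds at `y = P 1` by the choice of `ψ`. By `hFf` the part of it that depends
      -- on `y` has derivative zero, so it holds on all of `K`.
      have hd : ∀ y ∈ K, HasDerivAt (fun y => μ ^ 2 * F (μ * x + x₁) (σ * y + φ x) - f x y
          + σ * φ₂ x * y) 0 y := by
        intro y hy
        obtain ⟨b1, b2, b3⟩ := hball (show (x, y) ∈ J ×ˢ K from ⟨hx, hy⟩)
        have e1 : HasDerivAt (fun y => F (μ * x + x₁) (σ * y + φ x))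
            (dY F (μ * x + x₁) (σ * y + φ x) * σ) y :=
          HasDerivAt.comp (h₂ := fun t => F (μ * x + x₁) t) y (hF'.hasDerivAt_dY hO' b3)
            (by simpa using ((hasDerivAt_id y).const_mul σ).add_const (φ x))
        refine (((e1.const_mul (μ ^ 2)).sub (hf'.hasDerivAt_dY hO (hDO b1))).add
          ((hasDerivAt_id y).const_mul (σ * φ₂ x))).congr_deriv ?_
        linear_combination hFf x y b1 b2 b3
      have hconst := Metric.isOpen_ball.is_const_of_deriv_eq_zero
        (convex_ball (P 1) r).isPreconnected
        (fun y hy => (hd y hy).differentiableAt.differentiableWithinAt) (fun y hy => (hd y hy).deriv)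
        hy hK0
      simp only at hconst ⊢
      rw [hσ]
      field_simp
      linear_combination 2 * hconst)
  rw [hσ] at hT
  refine ⟨T, hT, hs ▸ ⟨hJ0, hK0⟩, ?_⟩
  rw [hTe, fibreMap, hψ0]
  congr
  ring

end LocalIsometry

/-! ### Local homogeneity of inverse-square potentials. -/

section InverseSquare

variable {O : Set (ℝ × ℝ)} {hO : IsOpen O} {f : ℝ → ℝ → ℝ}
  {hf : ContDiffOn ℝ ∞ (Function.uncurry f) O}

theorem walker_isLocallyHomogeneous (h : IsInverseSquareQuadratic O f) :
    (walker O hO f hf).IsLocallyHomogeneous := by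
  obtain ⟨a, x₀, β, γ, ha, hβ, -, h⟩ := h
  intro P hP Q hQ
  have hP' : (P 0, P 1) ∈ O := hP
  have hQ' : (Q 0, Q 1) ∈ O := hQ
  have hf1 : ∀ x y, (x, y) ∈ O → dY f x y = 2 * (a * ((x - x₀) ^ 2)⁻¹) * y + β x := fun x y hq =>
    (dY_dY_of_quadratic hO (A := fun x => a * ((x - x₀) ^ 2)⁻¹) (fun q hq => (h q hq).2) x y hq).1
  have hP0 : P 0 - x₀ ≠ 0 := sub_ne_zero.2 (h _ hP').1
  have hQ0 : Q 0 - x₀ ≠ 0 := sub_ne_zero.2 (h _ hQ').1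
  -- The map `x ↦ μ x + x₁` is the dilation about `x₀` that takes `P 0` to `Q 0`; it leaves `a (x -
  -- x₀)⁻² dx²` invariant.
  set μ := (Q 0 - x₀) / (P 0 - x₀) with hμ_def
  have hμ : μ ≠ 0 := div_ne_zero hQ0 hP0
  set x₁ := x₀ - μ * x₀ with hx₁
  have hPQ : μ * P 0 + x₁ = Q 0 := by
    rw [hx₁, hμ_def]
    field_simp
    ring
  set pr := Prod.fst '' O with hpr
  have hpro : IsOpen pr := isOpenMap_fst O hO
  set I := pr ∩ (fun x => μ * x + x₁) ⁻¹' pr with hI_def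
  have hI : IsOpen I := hpro.inter (hpro.preimage (by fun_prop))
  have hne : ∀ x ∈ I, x - x₀ ≠ 0 := by
    rintro x ⟨⟨q, hq, rfl⟩, -⟩
    exact sub_ne_zero.2 (h q hq).1
  have hPI : P 0 ∈ I := ⟨⟨_, hP', rfl⟩, by
    change μ * P 0 + x₁ ∈ pr
    rw [hPQ]
    exact ⟨_, hQ', rfl⟩⟩
  have hA : ContDiffOn ℝ ∞ (fun x => 2 * (a * ((x - x₀) ^ 2)⁻¹)) I :=
    contDiffOn_const.mul (contDiffOn_const.mul
      (((contDiffOn_id.sub contDiffOn_const).pow 2).inv fun x hx => pow_ne_zero 2 (hne x hx)))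
  have hb : ContDiffOn ℝ ∞ (fun x => β x - μ ^ 2 * β (μ * x + x₁)) I :=
    (hβ.mono Set.inter_subset_left).sub (contDiffOn_const.mul
      (hβ.comp (ContDiff.contDiffOn (by fun_prop)) fun x hx => hx.2))
  -- The shift `φ` has to satisfy `φ'' = β(x) - μ² β(μ x + x₁) - 2a (x - x₀)⁻² φ`, which is the
  -- matching of the `y`-derivatives; its value at `P 0` takes `P 1` to `Q 1`.
  obtain ⟨r, φ, φ₁, hr, hrI, hφ, hφ₁, hdφ, hdφ₁, hφ0⟩ :=
    exists_linear_ode_solution hI hPI hA hb (Q 1 - P 1)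
  obtain ⟨T, hT, hPT, hTP⟩ := exists_local_isometry (hO := hO) (hf := hf) (hO' := hO) (hF := hf)
    (σ := 1) (x₁ := x₁) (one_pow 2) hμ Metric.isOpen_ball hφ hφ₁
    ((hb.mono hrI).sub ((hA.mono hrI).mul hφ)) hdφ hdφ₁ hO subset_rfl hP' (Metric.mem_ball_self hr)
    (by rw [hPQ, hφ0]; convert hQ' using 2; ring) (by
      intro x y hq hx hq'
      rw [hf1 _ _ hq, hf1 _ _ hq']
      have e : μ * x + x₁ - x₀ = μ * (x - x₀) := by rw [hx₁]; ring
      have := hne x (hrI hx)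
      rw [e]
      field_simp
      ring) (Q 2)
  refine ⟨T, hT, hPT, ?_⟩
  rw [hTP, hPQ, hφ0]
  ext i
  fin_cases i <;> simp

end InverseSquare

/-! ### Transitive groups on the model manifolds. -/

/-- A translation by `c` in `y` is compensated by scaling `x` by `μ` and `x̃` by `1/μ`; translations
in `x` and `x̃` are always isometries here. -/
theorem walker_univ_isHomogeneous {g : ℝ → ℝ} {hO : IsOpen (Set.univ : Set (ℝ × ℝ))}
    {hf : ContDiffOn ℝ ∞ (Function.uncurry fun _ y : ℝ => g y) Set.univ}
    (h : ∀ c : ℝ, ∃ μ : ℝ, μ ≠ 0 ∧ ∀ y, μ ^ 2 * g (y + c) = g y) :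
    (walker Set.univ hO (fun _ y => g y) hf).IsHomogeneous := by
  intro P _ Q _
  set c := Q 1 - P 1 with hc
  obtain ⟨μ, hμ, hk⟩ := h c
  obtain ⟨T, hT, hs, ht, hTe⟩ := exists_isLocalHomothety (hO := hO) (hf := hf) (hO' := hO)
    (hF := hf) (l := 1) (x₁ := Q 0 - μ * P 0) one_ne_zero hμ isOpen_univ
    (φ := fun _ => c) (φ₁ := fun _ => 0) (φ₂ := fun _ => 0) (ψ := fun _ => Q 2 - 1 / μ * P 2)
    (ψ₁ := fun _ => 0) contDiffOn_const contDiffOn_const contDiffOn_const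
    (fun x _ => hasDerivAt_const x _) (fun x _ => hasDerivAt_const x _)
    (fun x _ => hasDerivAt_const x _) (D := Set.univ) isOpen_univ (Set.subset_univ _)
    (fun _ _ => Set.mem_univ _) (fun _ _ => Set.mem_univ _) (by
      intro q _
      rw [one_mul, hk]
      ring)
  refine ⟨T, by simpa using hT, by rw [hs]; rfl, by rw [ht]; rfl, ?_⟩
  rw [hTe]
  ext i
  fin_cases i <;> simp [fibreMap, hc]

theorem walkerExp_isHomogeneous (s a : ℝ) : (walkerExp s a).IsHomogeneous := by
  refine walker_univ_isHomogeneous (g := fun y => s * Real.exp (a * y)) fun c =>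
    ⟨Real.exp (-(a * c / 2)), (Real.exp_pos _).ne', fun y => ?_⟩
  have e : Real.exp (-(a * c / 2)) ^ 2 * Real.exp (a * c) = 1 := by
    rw [← Real.exp_nat_mul, ← Real.exp_add, Real.exp_eq_one_iff]
    push_cast
    ring
  simp only [mul_add, Real.exp_add]
  linear_combination s * Real.exp (a * y) * e

section HalfPlane

variable {g : ℝ → ℝ} {hO : IsOpen {q : ℝ × ℝ | 0 < q.2}}
  {hf : ContDiffOn ℝ ∞ (Function.uncurry fun _ y : ℝ => g y) {q : ℝ × ℝ | 0 < q.2}}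

/-- Scaling `y` by `l` is completed to a homothety by scaling `x` by `μ`; an additive constant `μ k`
in the potential is absorbed by a shift of `x̃` linear in `x`. -/
theorem walker_halfPlane_isHomothetyHomogeneous
    (h : ∀ l : ℝ, 0 < l → ∃ μ k : ℝ, μ ≠ 0 ∧ ∀ y, 0 < y → μ ^ 2 * g (l * y) = l ^ 2 * g y + μ * k) :
    (walker {q | 0 < q.2} hO (fun _ y => g y) hf).IsHomothetyHomogeneous := by
  intro P hP Q hQ
  change 0 < P 1 at hP
  change 0 < Q 1 at hQ
  set l := Q 1 / P 1 with hl_def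
  have hl : 0 < l := div_pos hQ hP
  obtain ⟨μ, k, hμ, hk⟩ := h l hl
  obtain ⟨T, hT, hs, ht, hTe⟩ := exists_isLocalHomothety (hO := hO) (hf := hf) (hO' := hO)
    (hF := hf) (l := l) (x₁ := Q 0 - μ * P 0) hl.ne' hμ isOpen_univ
    (φ := fun _ => 0) (φ₁ := fun _ => 0) (φ₂ := fun _ => 0)
    (ψ := fun x => k * x + (Q 2 - l ^ 2 / μ * P 2 - k * P 0))
    (ψ₁ := fun _ => k) contDiffOn_const contDiffOn_const (ContDiff.contDiffOn (by fun_prop))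
    (fun x _ => hasDerivAt_const x _) (fun x _ => hasDerivAt_const x _)
    (fun x _ => by
      simpa using ((hasDerivAt_id x).const_mul k).add_const (Q 2 - l ^ 2 / μ * P 2 - k * P 0)) (D := {q | 0 < q.2})
    hO subset_rfl (fun _ _ => Set.mem_univ _)
    (fun q hq => by simpa using mul_pos hl hq) (by
      intro q hq
      simp only [add_zero]
      rw [hk q.2 hq]
      ring)
  refine ⟨l, T, hl.ne', hT, by rw [hs]; rfl, ?_, ?_⟩
  · rw [ht]
    ext p
    change 0 < (p 1 - 0) / l ↔ 0 < p 1
    rw [sub_zero, div_pos_iff_of_pos_right hl]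
  · rw [hTe]
    ext i
    fin_cases i
    · simp [fibreMap]
    · simp only [fibreMap, hl_def]
      simp
      field_simp
    · simp [fibreMap]

end HalfPlane

theorem walkerLog_isHomothetyHomogeneous (s : ℝ) : (walkerLog s).IsHomothetyHomogeneous := by
  refine walker_halfPlane_isHomothetyHomogeneous (g := fun y => s * Real.log y) fun l hl =>
    ⟨l, l * s * Real.log l, hl.ne', fun y hy => ?_⟩
  simp only [Real.log_mul hl.ne' hy.ne']
  ring

theorem walkerPow_isHomothetyHomogeneous (s ε : ℝ) : (walkerPow s ε).IsHomothetyHomogeneous := by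
  refine walker_halfPlane_isHomothetyHomogeneous (g := fun y => s * y ^ ε) fun l hl =>
    -- The exponent `1 - ε/2` of `l` solves `μ² l^ε = l²`.
    ⟨l * l ^ (-(ε / 2)), 0, by positivity, fun y hy => ?_⟩
  have e : (l ^ (-(ε / 2))) ^ 2 * l ^ ε = 1 := by
    rw [← Real.rpow_natCast, ← Real.rpow_mul hl.le, ← Real.rpow_add hl]
    norm_num
  simp only [Real.mul_rpow hl.le hy.le]
  linear_combination (l ^ 2 * s * y ^ ε) * e

/-! ### Rigidity: an invariant of local isometries when `f = g(y)`. -/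

section PartialDCalculus

variable {n : ℕ} {U : Set (Fin n → ℝ)} {φ : (Fin n → ℝ) → ℝ}

theorem ContDiffOn.partialD (h : ContDiffOn ℝ ∞ φ U) (hU : IsOpen U) (i : Fin n) :
    ContDiffOn ℝ ∞ (partialD i φ) U :=
  (ContDiffOn.fderiv_of_isOpen h hU (by simp)).clm_apply contDiffOn_const

theorem ContDiffOn.partialD_comm (h : ContDiffOn ℝ ∞ φ U) (hU : IsOpen U) {p : Fin n → ℝ}
    (hp : p ∈ U) (i j : Fin n) :
    _root_.partialD i (_root_.partialD j φ) p = _root_.partialD j (_root_.partialD i φ) p := by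
  have hs : IsSymmSndFDerivAt ℝ φ p :=
    (h.contDiffAt (hU.mem_nhds hp)).isSymmSndFDerivAt
      (by simp only [minSmoothness_of_isRCLikeNormedField]; exact WithTop.coe_le_coe.2 (le_top : (2 : ℕ∞) ≤ ⊤))
  have hd : DifferentiableAt ℝ (fderiv ℝ φ) p :=
    ((ContDiffOn.fderiv_of_isOpen (m := ∞) h hU (by simp)).contDiffAt
      (hU.mem_nhds hp)).differentiableAt (by simp)
  have e : ∀ k l, _root_.partialD k (_root_.partialD l φ) p
      = fderiv ℝ (fderiv ℝ φ) p (Pi.single k 1) (Pi.single l 1) := by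
    intro k l
    change fderiv ℝ (fun q => fderiv ℝ φ q (Pi.single l 1)) p (Pi.single k 1) = _
    rw [fderiv_clm_apply hd (by fun_prop)]
    simp
  rw [e, e]
  exact hs _ _

theorem ContDiffOn.hasDerivAt_line (h : ContDiffOn ℝ ∞ φ U) (hU : IsOpen U) {p : Fin n → ℝ}
    (hp : p ∈ U) (i : Fin n) :
    HasDerivAt (fun t : ℝ => φ (p + t • Pi.single i 1)) (_root_.partialD i φ p) 0 := by
  have h1 : HasDerivAt (fun t : ℝ => p + t • (Pi.single i 1 : Fin n → ℝ)) (Pi.single i 1) 0 := by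
    simpa using ((hasDerivAt_id (0 : ℝ)).smul_const (Pi.single i (1 : ℝ) : Fin n → ℝ)).const_add p
  exact ((h.contDiffAt (hU.mem_nhds hp)).differentiableAt (by simp)).hasFDerivAt.comp_hasDerivAt_of_eq
    0 h1 (by simp)

theorem eventually_line_mem (hU : IsOpen U) {p : Fin n → ℝ} (hp : p ∈ U) (i : Fin n) :
    ∀ᶠ t : ℝ in nhds 0, p + t • (Pi.single i 1 : Fin n → ℝ) ∈ U := by
  have : ContinuousAt (fun t : ℝ => p + t • (Pi.single i 1 : Fin n → ℝ)) 0 := by fun_prop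
  exact this (hU.mem_nhds (by simpa using hp))

/-- Differentiation of an identity `φ = χ` on an open set along a coordinate line. -/
theorem hasDerivAt_line_unique (hU : IsOpen U) {p : Fin n → ℝ} (hp : p ∈ U) (i : Fin n)
    {φ χ : (Fin n → ℝ) → ℝ} (h : ∀ q ∈ U, φ q = χ q) {a b : ℝ}
    (hφ : HasDerivAt (fun t : ℝ => φ (p + t • Pi.single i 1)) a 0)
    (hχ : HasDerivAt (fun t : ℝ => χ (p + t • Pi.single i 1)) b 0) : a = b :=
  (hχ.congr_of_eventuallyEq ((eventually_line_mem hU hp i).mono fun _ ht => h _ ht)).unique hφ |>.symm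

theorem partialD_eq_zero_of_eq_const (hU : IsOpen U) {p : Fin n → ℝ} (hp : p ∈ U) (i : Fin n)
    {φ : (Fin n → ℝ) → ℝ} (c : ℝ) (h : ∀ q ∈ U, φ q = c) : partialD i φ p = 0 := by
  rw [partialD_congr hU (χ := fun _ => c) h hp, partialD]
  simp

end PartialDCalculus

section Rigidity

variable {O : Set (ℝ × ℝ)} {hO : IsOpen O} {g g₁ g₂ g₃ : ℝ → ℝ}
  {hf : ContDiffOn ℝ ∞ (Function.uncurry fun _ y : ℝ => g y) O}

theorem hasDerivAt_coord_line {n : ℕ} (p : Fin n → ℝ) (i j : Fin n) :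
    HasDerivAt (fun t : ℝ => (p + t • (Pi.single i 1 : Fin n → ℝ)) j)
      ((Pi.single i 1 : Fin n → ℝ) j) 0 := by
  simpa using ((hasDerivAt_id (0 : ℝ)).mul_const ((Pi.single i 1 : Fin n → ℝ) j)).const_add (p j)

/-- A local isometry of a Walker manifold with `f = g(y)` preserves `(g''' / g'')²`. -/
theorem PseudoRiemannianDomain.IsLocalHomothety.sq_third_div_second
    {T : OpenPartialHomeomorph (Fin 3 → ℝ) (Fin 3 → ℝ)}
    (hT : (walker O hO (fun _ y => g y) hf).IsLocalHomothety
      (walker O hO (fun _ y => g y) hf) 1 T)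
    (h₁ : ∀ q ∈ O, HasDerivAt g (g₁ q.2) q.2) (h₂ : ∀ q ∈ O, HasDerivAt g₁ (g₂ q.2) q.2)
    (h₃ : ∀ q ∈ O, HasDerivAt g₂ (g₃ q.2) q.2) (hne : ∀ q ∈ O, g₂ q.2 ≠ 0)
    {p : Fin 3 → ℝ} (hp : p ∈ T.source) :
    g₃ (p 1) ^ 2 * g₂ (T p 1) ^ 2 = g₃ (T p 1) ^ 2 * g₂ (p 1) ^ 2 := by
  set U := T.source with hU_def
  have hU : IsOpen U := T.open_source
  have hUO : ∀ q ∈ U, (q 0, q 1) ∈ O := fun q hq => hT.source_subset hq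
  have hTO : ∀ q ∈ U, (T q 0, T q 1) ∈ O := fun q hq => hT.target_subset (T.map_source hq)
  let C : Fin 3 → (Fin 3 → ℝ) → ℝ := fun a q => T q a
  have hC : ∀ a, ContDiffOn ℝ ∞ (C a) U := fun a => contDiffOn_pi.1 hT.smooth a
  let J : Fin 3 → Fin 3 → (Fin 3 → ℝ) → ℝ := fun a i => partialD i (C a)
  have hJ : ∀ a i, ContDiffOn ℝ ∞ (J a i) U := fun a i => (hC a).partialD hU i
  let H : Fin 3 → Fin 3 → Fin 3 → (Fin 3 → ℝ) → ℝ := fun a i j => partialD i (J a j)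
  have hH : ∀ a i j, ContDiffOn ℝ ∞ (H a i j) U := fun a i j => (hJ a j).partialD hU i
  have hsymm : ∀ a i j, ∀ q ∈ U, H a i j q = H a j i q := fun a i j q hq =>
    (hC a).partialD_comm hU hq i j
  have hfd : ∀ q ∈ U, ∀ i a, fderiv ℝ T q (Pi.single i 1) a = J a i q := by
    intro q hq i a
    have hd : DifferentiableAt ℝ T q :=
      (hT.smooth.contDiffAt (hU.mem_nhds hq)).differentiableAt (by simp)
    change _ = fderiv ℝ (fun q => T q a) q (Pi.single i 1)
    rw [(hasFDerivAt_pi'.1 hd.hasFDerivAt a).fderiv]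
    rfl
  let G : Fin 3 → Fin 3 → (Fin 3 → ℝ) → ℝ := fun i j q =>
    (!![-2 * g (q 1), 0, 1; 0, 1, 0; 1, 0, 0] : Matrix (Fin 3) (Fin 3) ℝ) i j
  have hE : ∀ i j, ∀ q ∈ U, -2 * g (T q 1) * J 0 i q * J 0 j q + J 0 i q * J 2 j q
      + J 2 i q * J 0 j q + J 1 i q * J 1 j q = G i j q := by
    intro i j q hq
    have := hT.pullback_metric q hq (Pi.single i 1) (Pi.single j 1)
    rw [walker_innerAt, walker_innerAt, one_mul] at this
    simp only [hfd q hq] at this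
    rw [this]
    fin_cases i <;> fin_cases j <;> simp [G]
  -- the inverse metric
  have hinv : ∀ q ∈ U,
      (2 * J 0 0 q * J 0 2 q + J 0 1 q ^ 2 + 2 * g (q 1) * J 0 2 q ^ 2 = 0) ∧
      (J 0 0 q * J 1 2 q + J 0 2 q * J 1 0 q + J 0 1 q * J 1 1 q
        + 2 * g (q 1) * J 0 2 q * J 1 2 q = 0) ∧
      (J 0 0 q * J 2 2 q + J 0 2 q * J 2 0 q + J 0 1 q * J 2 1 q
        + 2 * g (q 1) * J 0 2 q * J 2 2 q = 1) := by
    intro q hq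
    let Jm : Matrix (Fin 3) (Fin 3) ℝ := Matrix.of fun a i => J a i q
    let Gt : Matrix (Fin 3) (Fin 3) ℝ := !![-2 * g (T q 1), 0, 1; 0, 1, 0; 1, 0, 0]
    let Gti : Matrix (Fin 3) (Fin 3) ℝ := !![0, 0, 1; 0, 1, 0; 1, 0, 2 * g (T q 1)]
    let Gs : Matrix (Fin 3) (Fin 3) ℝ := !![-2 * g (q 1), 0, 1; 0, 1, 0; 1, 0, 0]
    let Gsi : Matrix (Fin 3) (Fin 3) ℝ := !![0, 0, 1; 0, 1, 0; 1, 0, 2 * g (q 1)]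
    have e1 : Jm.transpose * Gt * Jm = Gs := by
      ext i j
      have := hE i j q hq
      simp only [Matrix.mul_apply, Fin.sum_univ_three, Matrix.transpose_apply]
      simp [Jm, Gt, Gs, G] at this ⊢
      rw [← this]
      ring
    have e2 : Gsi * Gs = 1 := by
      ext i j
      fin_cases i <;> fin_cases j <;> simp [Gsi, Gs, Matrix.mul_apply, Fin.sum_univ_three]
    have e3 : Gt * Gti = 1 := by
      ext i j
      fin_cases i <;> fin_cases j <;> simp [Gt, Gti, Matrix.mul_apply, Fin.sum_univ_three]
    -- A one-sided inverse of a square matrix is two-sided, which turns `Jᵀ G̃ J = G` into `J G⁻¹ Jᵀ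
    -- = G̃⁻¹`.
    have e4 : Jm * (Gsi * Jm.transpose * Gt) = 1 := by
      rw [mul_eq_one_comm]
      calc Gsi * Jm.transpose * Gt * Jm = Gsi * (Jm.transpose * Gt * Jm) := by
            simp only [Matrix.mul_assoc]
        _ = 1 := by rw [e1, e2]
    have e5 : Jm * Gsi * Jm.transpose = Gti := by
      calc Jm * Gsi * Jm.transpose = Jm * (Gsi * Jm.transpose * Gt) * Gti := by
            simp only [Matrix.mul_assoc, e3, Matrix.mul_one]
        _ = Gti := by rw [e4, Matrix.one_mul]
    have k := fun b => congrFun (congrFun e5 0) b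
    have k0 := k 0
    have k1 := k 1
    have k2 := k 2
    simp only [Matrix.mul_apply, Fin.sum_univ_three, Matrix.transpose_apply] at k0 k1 k2
    simp [Jm, Gsi, Gti] at k0 k1 k2
    refine ⟨?_, ?_, ?_⟩
    · linear_combination k0
    · linear_combination k1
    · linear_combination k2
  have hgT : ∀ q ∈ U, ∀ k, HasDerivAt (fun t : ℝ => g (T (q + t • Pi.single k 1) 1))
      (g₁ (T q 1) * J 1 k q) 0 := fun q hq k =>
    HasDerivAt.comp_of_eq 0 (h₁ _ (hTO q hq)) ((hC 1).hasDerivAt_line hU hq k) (by simp)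
  have hG : ∀ q ∈ U, ∀ i j k, HasDerivAt (fun t : ℝ => G i j (q + t • Pi.single k 1))
      (if i = 0 ∧ j = 0 ∧ k = 1 then -2 * g₁ (q 1) else 0) 0 := by
    intro q hq i j k
    by_cases hij : i = 0 ∧ j = 0
    · obtain ⟨rfl, rfl⟩ := hij
      have := (HasDerivAt.comp_of_eq (h₂ := g) 0 (h₁ _ (hUO q hq)) (hasDerivAt_coord_line q k 1)
        (by simp)).const_mul (-2)
      refine this.congr_deriv ?_
      fin_cases k <;> simp
    · have : (fun t : ℝ => G i j (q + t • Pi.single k 1)) = fun _ => G i j q := by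
        funext t
        fin_cases i <;> fin_cases j <;> simp [G] at hij ⊢
      rw [this, if_neg fun h => hij ⟨h.1, h.2.1⟩]
      exact hasDerivAt_const _ _
  have hdE : ∀ q ∈ U, ∀ i j k,
      -2 * (g₁ (T q 1) * J 1 k q * J 0 i q * J 0 j q
        + g (T q 1) * (H 0 k i q * J 0 j q + J 0 i q * H 0 k j q))
      + (H 0 k i q * J 2 j q + J 0 i q * H 2 k j q) + (H 2 k i q * J 0 j q + J 2 i q * H 0 k j q)
      + (H 1 k i q * J 1 j q + J 1 i q * H 1 k j q)
      = if i = 0 ∧ j = 0 ∧ k = 1 then -2 * g₁ (q 1) else 0 := by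
    intro q hq i j k
    have d := fun a l => (hJ a l).hasDerivAt_line hU hq k
    refine hasDerivAt_line_unique hU hq k (hE i j) ?_ (hG q hq i j k)
    refine ((((((hgT q hq k).const_mul (-2)).mul (d 0 i)).mul (d 0 j)).add
      ((d 0 i).mul (d 2 j))).add ((d 2 i).mul (d 0 j))).add ((d 1 i).mul (d 1 j))
      |>.congr_deriv ?_
    simp only [zero_smul, add_zero, H, Pi.mul_apply]
    ring
  -- `dx` pulls back to a form with covariant Hessian zero
  have hX : ∀ q ∈ U, ∀ i j, 2 * H 0 i j q =
      ∑ k, ((if j = 0 ∧ k = 0 ∧ i = 1 then -2 * g₁ (q 1) else 0)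
        + (if i = 0 ∧ k = 0 ∧ j = 1 then -2 * g₁ (q 1) else 0)
        - (if i = 0 ∧ j = 0 ∧ k = 1 then -2 * g₁ (q 1) else 0))
        * ![J 0 2 q, J 0 1 q, J 0 0 q + 2 * g (q 1) * J 0 2 q] k := by
    intro q hq i j
    -- The sum contracts Christoffel symbols of the first kind with the gradient of `x ∘ T`. By
    -- `hinv` the inner products of `d(x ∘ T)` with the differentials of the components of `T` are
    -- `0, 0, 1`, which isolates `∂ᵢ∂ⱼ(x ∘ T)`.
    obtain ⟨n0, n1, n2⟩ := hinv q hq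
    rw [Fin.sum_univ_three, ← hdE q hq j 0 i, ← hdE q hq i 0 j, ← hdE q hq i j 0,
      ← hdE q hq j 1 i, ← hdE q hq i 1 j, ← hdE q hq i j 1, ← hdE q hq j 2 i, ← hdE q hq i 2 j,
      ← hdE q hq i j 2]
    have s := fun a k l => hsymm a k l q hq
    simp only [Matrix.cons_val_zero, Matrix.cons_val_one, Matrix.cons_val]
    rw [s 0 0 i, s 0 0 j, s 0 1 i, s 0 1 j, s 0 2 i, s 0 2 j, s 1 0 i, s 1 0 j, s 1 1 i, s 1 1 j,
      s 1 2 i, s 1 2 j, s 2 0 i, s 2 0 j, s 2 1 i, s 2 1 j, s 2 2 i, s 2 2 j, s 0 j i, s 1 j i,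
      s 2 j i]
    linear_combination (-2 * H 0 i j q) * n2
      - (-4 * g (T q 1) * H 0 i j q + 2 * H 2 i j q
        - 2 * g₁ (T q 1) * (J 1 i q * J 0 j q + J 1 j q * J 0 i q)) * n0
      - (2 * H 1 i j q + 2 * g₁ (T q 1) * J 0 i q * J 0 j q) * n1
  -- Third derivatives commute: this is the integrability condition that produces `g''` below.
  have hcross : ∀ q ∈ U, ∀ a j, (∀ q ∈ U, H a 1 j q = 0) → partialD 1 (H a 0 j) q = 0 := by
    intro q hq a j h
    rw [(hJ a j).partialD_comm hU hq 1 0]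
    exact partialD_eq_zero_of_eq_const hU hq 0 0 h
  have hline : ∀ {φ φ' : ℝ → ℝ}, (∀ q ∈ O, HasDerivAt φ (φ' q.2) q.2) → ∀ q ∈ U,
      HasDerivAt (fun t : ℝ => φ ((q + t • (Pi.single 1 1 : Fin 3 → ℝ)) 1)) (φ' (q 1)) 0 := by
    intro φ φ' h q hq
    refine (HasDerivAt.comp_of_eq (h₂ := φ) 0 (h _ (hUO q hq)) (hasDerivAt_coord_line q 1 1)
      (by simp)).congr_deriv (by simp)
  have hlineT : ∀ {φ φ' : ℝ → ℝ}, (∀ q ∈ O, HasDerivAt φ (φ' q.2) q.2) → ∀ q ∈ U,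
      HasDerivAt (fun t : ℝ => φ (T (q + t • (Pi.single 1 1 : Fin 3 → ℝ)) 1))
        (φ' (T q 1) * J 1 1 q) 0 := fun h q hq =>
    HasDerivAt.comp_of_eq 0 (h _ (hTO q hq)) ((hC 1).hasDerivAt_line hU hq 1) (by simp)
  have hX00 : ∀ q ∈ U, H 0 0 0 q = g₁ (q 1) * J 0 1 q := by
    intro q hq
    have := hX q hq 0 0
    simp at this
    linear_combination this / 2
  have hX01 : ∀ q ∈ U, H 0 0 1 q = -(g₁ (q 1) * J 0 2 q) := by
    intro q hq
    have := hX q hq 0 1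
    simp at this
    linear_combination this / 2
  have hX11 : ∀ q ∈ U, H 0 1 1 q = 0 := by
    intro q hq
    have := hX q hq 1 1
    simpa using this
  have hX12 : ∀ q ∈ U, H 0 1 2 q = 0 := by
    intro q hq
    have := hX q hq 1 2
    simpa using this
  -- Differentiating `hX01` in `y` leaves `g'' ∂(x ∘ T)/∂x̃ = 0`, and `g'' ≠ 0`. The same argument
  -- with `hX00` shows that `x ∘ T` does not depend on `y`.
  have hJ02 : ∀ q ∈ U, J 0 2 q = 0 := by
    intro q hq
    have := hasDerivAt_line_unique hU hq 1 hX01 ((hH 0 0 1).hasDerivAt_line hU hq 1)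
      (((hline h₂ q hq).mul ((hJ 0 2).hasDerivAt_line hU hq 1)).neg)
    rw [hcross q hq 0 1 hX11] at this
    have e : partialD 1 (J 0 2) q = 0 := hX12 q hq
    simpa [e, hne _ (hUO q hq)] using this
  have hX01' : ∀ q ∈ U, H 0 0 1 q = 0 := fun q hq => by rw [hX01 q hq, hJ02 q hq]; ring
  have hX10' : ∀ q ∈ U, H 0 1 0 q = 0 := fun q hq => by rw [hsymm 0 1 0 q hq, hX01' q hq]
  have hJ01 : ∀ q ∈ U, J 0 1 q = 0 := by
    intro q hq
    have := hasDerivAt_line_unique hU hq 1 hX00 ((hH 0 0 0).hasDerivAt_line hU hq 1)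
      ((hline h₂ q hq).mul ((hJ 0 1).hasDerivAt_line hU hq 1))
    rw [hcross q hq 0 0 hX10'] at this
    have e : partialD 1 (J 0 1) q = 0 := hX11 q hq
    simpa [e, hne _ (hUO q hq)] using this
  have hX00' : ∀ q ∈ U, H 0 0 0 q = 0 := fun q hq => by rw [hX00 q hq, hJ01 q hq]; ring
  have hJ11 : ∀ q ∈ U, J 1 1 q ^ 2 = 1 := by
    intro q hq
    have := hE 1 1 q hq
    simp [hJ01 q hq, G] at this
    linear_combination this
  have hJ11' : ∀ q ∈ U, J 1 1 q ≠ 0 := by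
    intro q hq h
    have := hJ11 q hq
    simp [h] at this
  have hY01 : ∀ q ∈ U, H 1 0 1 q = 0 := by
    intro q hq
    have := hdE q hq 1 1 0
    simp [hJ01 q hq, hX01' q hq] at this
    have e : H 1 0 1 q * J 1 1 q = 0 := by linear_combination this / 2
    exact (mul_eq_zero.1 e).resolve_right (hJ11' q hq)
  have hY11 : ∀ q ∈ U, H 1 1 1 q = 0 := by
    intro q hq
    have := hdE q hq 1 1 1
    simp [hJ01 q hq, hX11 q hq] at this
    have e : H 1 1 1 q * J 1 1 q = 0 := by linear_combination this / 2
    exact (mul_eq_zero.1 e).resolve_right (hJ11' q hq)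
  have hY10 : ∀ q ∈ U, H 1 1 0 q = 0 := fun q hq => by rw [hsymm 1 1 0 q hq, hY01 q hq]
  -- Two derivatives of the metric identity are combined so that the second derivatives of `x̃ ∘ T`
  -- cancel. Two further `y`-derivatives give the transformation of `g''` and `g'''`; the sign `J 1
  -- 1` disappears on squaring.
  have hfst : ∀ q ∈ U, g₁ (q 1) = g₁ (T q 1) * J 1 1 q * J 0 0 q ^ 2 + H 1 0 0 q * J 1 1 q := by
    intro q hq
    have e1 := hdE q hq 0 0 1
    have e2 := hdE q hq 0 1 0
    simp [hJ01 q hq, hX01' q hq, hX10' q hq, hX00' q hq, hY01 q hq, hY10 q hq] at e1 e2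
    rw [hsymm 2 0 1 q hq] at e2
    linear_combination e1 / 2 - e2
  have hsnd : ∀ q ∈ U, g₂ (q 1) = g₂ (T q 1) * J 0 0 q ^ 2 := by
    intro q hq
    have d0 := (hJ 0 0).hasDerivAt_line hU hq 1
    have d1 := (hJ 1 1).hasDerivAt_line hU hq 1
    have := hasDerivAt_line_unique hU hq 1 hfst (hline h₂ q hq)
      ((((hlineT h₂ q hq).mul d1).mul (d0.fun_pow 2)).add
        (((hH 1 0 0).hasDerivAt_line hU hq 1).mul d1))
    rw [hcross q hq 1 0 hY10, show partialD 1 (J 1 1) q = 0 from hY11 q hq,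
      show partialD 1 (J 0 0) q = 0 from hX10' q hq] at this
    simp at this
    linear_combination this + g₂ (T q 1) * J 0 0 q ^ 2 * hJ11 q hq
  have hthd : ∀ q ∈ U, g₃ (q 1) = g₃ (T q 1) * J 1 1 q * J 0 0 q ^ 2 := by
    intro q hq
    have := hasDerivAt_line_unique hU hq 1 hsnd (hline h₃ q hq)
      ((hlineT h₃ q hq).mul (((hJ 0 0).hasDerivAt_line hU hq 1).fun_pow 2))
    rw [show partialD 1 (J 0 0) q = 0 from hX10' q hq] at this
    simpa using this
  rw [hthd p hp, hsnd p hp]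
  linear_combination (g₃ (T p 1) ^ 2 * J 0 0 p ^ 4 * g₂ (T p 1) ^ 2) * hJ11 p hp

end Rigidity

/-- Here `(g''' / g'')² = 4 / y²`, which differs at `y = 1` and `y = 2`. -/
theorem not_isLocallyHomogeneous_walkerLog {s : ℝ} (hs : s ≠ 0) :
    ¬ (walkerLog s).IsLocallyHomogeneous := by
  intro h
  obtain ⟨T, hT, hP, hTP⟩ := h ![0, 1, 0] (by simp [walkerLog, walker]) ![0, 2, 0]
    (by simp [walkerLog, walker])
  have := PseudoRiemannianDomain.IsLocalHomothety.sq_third_div_second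
    (g := fun y => s * Real.log y) (g₁ := fun y => s * y⁻¹) (g₂ := fun y => s * -(y ^ 2)⁻¹)
    (g₃ := fun y => s * (2 * y / (y ^ 2) ^ 2)) hT
    (fun q hq => (Real.hasDerivAt_log (ne_of_gt hq)).const_mul s)
    (fun q hq => (hasDerivAt_inv (ne_of_gt hq)).const_mul s)
    (fun q hq => (((hasDerivAt_pow 2 q.2).fun_inv (pow_ne_zero 2 (ne_of_gt hq))).fun_neg.const_mul
      s).congr_deriv (by norm_num; ring))
    (fun q hq => by
      have : (0 : ℝ) < q.2 := hq
      simp [hs, this.ne']) hP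
  rw [hTP] at this
  norm_num at this
  have h4 : 0 < s ^ 4 := by positivity
  nlinarith

/-- Here `(g''' / g'')² = (ε - 2)² / y²`; the excluded exponents are those with `g'' = 0` or `g''' =
0`. -/
theorem not_isLocallyHomogeneous_walkerPow {s ε : ℝ} (hs : s ≠ 0) (h0 : ε ≠ 0) (h1 : ε ≠ 1)
    (h2 : ε ≠ 2) : ¬ (walkerPow s ε).IsLocallyHomogeneous := by
  intro h
  obtain ⟨T, hT, hP, hTP⟩ := h ![0, 1, 0] (by simp [walkerPow, walker]) ![0, 2, 0]
    (by simp [walkerPow, walker])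
  have h1' : ε - 1 ≠ 0 := sub_ne_zero.2 h1
  have h2' : ε - 1 - 1 ≠ 0 := by
    intro h
    exact h2 (by linarith)
  have := PseudoRiemannianDomain.IsLocalHomothety.sq_third_div_second
    (g := fun y => s * y ^ ε) (g₁ := fun y => s * (ε * y ^ (ε - 1)))
    (g₂ := fun y => s * (ε * ((ε - 1) * y ^ (ε - 1 - 1))))
    (g₃ := fun y => s * (ε * ((ε - 1) * ((ε - 1 - 1) * y ^ (ε - 1 - 1 - 1))))) hT
    (fun q hq => (Real.hasDerivAt_rpow_const (Or.inl (ne_of_gt hq))).const_mul s)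
    (fun q hq => ((Real.hasDerivAt_rpow_const (Or.inl (ne_of_gt hq))).const_mul ε).const_mul s)
    (fun q hq => (((Real.hasDerivAt_rpow_const (Or.inl (ne_of_gt hq))).const_mul
      (ε - 1)).const_mul ε).const_mul s)
    (fun q hq => by
      have h : (0 : ℝ) < q.2 := hq
      have := Real.rpow_pos_of_pos h (ε - 1 - 1)
      positivity) hP
  rw [hTP] at this
  simp only [Matrix.cons_val_one, Matrix.cons_val_zero, Real.one_rpow] at this
  rw [Real.rpow_sub_one two_ne_zero (ε - 1 - 1)] at this
  have hpos := Real.rpow_pos_of_pos (two_pos : (0 : ℝ) < 2) (ε - 1 - 1)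
  set w := (2 : ℝ) ^ (ε - 1 - 1)
  have : 0 < (s * ε * (ε - 1) * (ε - 1 - 1) * s * ε * (ε - 1) * w) ^ 2 := by positivity
  nlinarith

/-! ### Classification at second order. -/

section ChainRule

variable {O : Set (ℝ × ℝ)} {φ χ : ℝ → ℝ → ℝ}

theorem SmoothOn.dX_comp (h : SmoothOn O φ) (hO : IsOpen O) {ψ : ℝ → ℝ} {d x y : ℝ}
    (hq : (x, y) ∈ O) (hψ : HasDerivAt ψ d (φ x y)) :
    _root_.dX (fun x y => ψ (φ x y)) x y = d * _root_.dX φ x y :=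
  (HasDerivAt.comp x hψ (h.hasDerivAt_dX hO hq)).deriv

theorem SmoothOn.dY_comp (h : SmoothOn O φ) (hO : IsOpen O) {ψ : ℝ → ℝ} {d x y : ℝ}
    (hq : (x, y) ∈ O) (hψ : HasDerivAt ψ d (φ x y)) :
    _root_.dY (fun x y => ψ (φ x y)) x y = d * _root_.dY φ x y :=
  (HasDerivAt.comp y hψ (h.hasDerivAt_dY hO hq)).deriv

theorem SmoothOn.comp {ψ : ℝ → ℝ} {S : Set ℝ} (hψ : ContDiffOn ℝ ∞ ψ S) (h : SmoothOn O φ)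
    (hS : ∀ x y, (x, y) ∈ O → φ x y ∈ S) : SmoothOn O fun x y => ψ (φ x y) :=
  ContDiffOn.comp (g := ψ) (t := S) hψ h fun q hq => hS q.1 q.2 hq

end ChainRule

section LocalIsometry

variable {O : Set (ℝ × ℝ)} {hO : IsOpen O} {f : ℝ → ℝ → ℝ}
  {hf : ContDiffOn ℝ ∞ (Function.uncurry f) O}
  {O' : Set (ℝ × ℝ)} {hO' : IsOpen O'} {g : ℝ → ℝ}
  {hg : ContDiffOn ℝ ∞ (Function.uncurry fun _ y : ℝ => g y) O'}

/-- A criterion for a Walker manifold to be locally isometric to one with `f = g(y)`. -/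
theorem isLocallyIsometricTo_of_coordinate {σ μ : ℝ} (hσ : σ ^ 2 = 1) (hμ : μ ≠ 0)
    {Y : ℝ → ℝ → ℝ} (hY : SmoothOn O Y) (hYy : ∀ x y, (x, y) ∈ O → dY Y x y = σ)
    (hYO' : ∀ x y, (x, y) ∈ O → ∀ t, (t, Y x y) ∈ O') {g' : ℝ → ℝ}
    (hg' : ∀ x y, (x, y) ∈ O → HasDerivAt g (g' (Y x y)) (Y x y))
    (hfg : ∀ x y, (x, y) ∈ O → dY f x y = σ * dX (dX Y) x y + μ ^ 2 * σ * g' (Y x y)) :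
    (walker O hO f hf).IsLocallyIsometricTo (walker O' hO' (fun _ y => g y) hg) := by
  intro P hP
  have hP' : (P 0, P 1) ∈ O := hP
  obtain ⟨r, hr, hball⟩ := Metric.isOpen_iff.1 hO (P 0, P 1) hP'
  rw [← ball_prod_same] at hball
  set J := Metric.ball (P 0) r
  set K := Metric.ball (P 1) r
  have hJ : IsOpen J := Metric.isOpen_ball
  have hK : IsOpen K := Metric.isOpen_ball
  have hJ0 : P 0 ∈ J := Metric.mem_ball_self hr
  have hK0 : P 1 ∈ K := Metric.mem_ball_self hr
  have hB : IsOpen (J ×ˢ K) := hJ.prod hK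
  have hmem : ∀ {x y}, x ∈ J → y ∈ K → (x, y) ∈ O := fun hx hy => hball ⟨hx, hy⟩
  have hk : ∀ {χ : ℝ → ℝ → ℝ}, SmoothOn O χ → ContDiffOn ℝ ∞ (fun x => χ x (P 1)) J := fun hχ =>
    ContDiffOn.comp (f := fun x => (x, P 1)) hχ (ContDiff.contDiffOn (by fun_prop))
      fun x hx => hmem hx hK0
  -- On a box `Y = σ y + φ(x)`, so `Y_xx = φ''` and the shift `φ` feeds `exists_local_isometry`.
  have hYe : ∀ x y, (x, y) ∈ J ×ˢ K → Y x y = σ * y + (Y x (P 1) - σ * P 1) := by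
    rintro x y ⟨hx, hy⟩
    have hd : ∀ y ∈ K, HasDerivAt (fun y => Y x y - σ * y) 0 y := by
      intro y hy
      refine ((hY.hasDerivAt_dY hO (hmem hx hy)).sub ((hasDerivAt_id y).const_mul σ)).congr_deriv ?_
      rw [hYy x y (hmem hx hy)]
      ring
    have := hK.is_const_of_deriv_eq_zero (convex_ball (P 1) r).isPreconnected
      (fun y hy => (hd y hy).differentiableAt.differentiableWithinAt) (fun y hy => (hd y hy).deriv)
      hy hK0
    simp only at this
    linear_combination this
  have hY1 : ∀ x y, (x, y) ∈ J ×ˢ K → dX Y x y = dX Y x (P 1) := by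
    intro x y hq
    rw [dX_congr hB hYe hq]
    simp [dX]
  have hY2 : ∀ x y, (x, y) ∈ J ×ˢ K → dX (dX Y) x y = dX (dX Y) x (P 1) := by
    intro x y hq
    rw [dX_congr hB (χ := fun x _ => dX Y x (P 1)) hY1 hq]
    rfl
  obtain ⟨T, hT, hPT, -⟩ := exists_local_isometry (hO := hO) (hf := hf) (hO' := hO') (hF := hg)
    (x₁ := 0) hσ hμ hJ (φ := fun x => Y x (P 1) - σ * P 1) (φ₁ := fun x => dX Y x (P 1))
    (φ₂ := fun x => dX (dX Y) x (P 1)) ((hk hY).sub contDiffOn_const) (hk (hY.dX hO))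
    (hk ((hY.dX hO).dX hO)) (fun x hx => (hY.hasDerivAt_dX hO (hmem hx hK0)).sub_const _)
    (fun x hx => (hY.dX hO).hasDerivAt_dX hO (hmem hx hK0)) hB hball (P := P) ⟨hJ0, hK0⟩ hJ0
    (by simpa using hYO' _ _ hP' (μ * P 0)) (by
      intro x y hq hx _
      rw [← hYe x y hq, ← hY2 x y hq, hfg x y (hball hq),
        show dY (fun _ y => g y) (μ * x + 0) (Y x y) = g' (Y x y) from (hg' x y (hball hq)).deriv]
      ring) 0
  exact ⟨T, hT, hPT⟩

end LocalIsometry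

section Classification

variable {O : Set (ℝ × ℝ)} {f h : ℝ → ℝ → ℝ}

/-- Modulo `∂x̃`, the vector `X = h_y ∂x - h_x ∂y` spans the kernel of `dh`, so models match it up
to scale and `b` drops out. With suitable powers of `h` and `h_y` as weights, `h_yy`, `Hess h (X,
∂y)²` and `Hess h (X, X)` become invariant; fractions are cleared. -/
theorem JetRelationTwo.invariants {P Q : ℝ × ℝ} {lam a b σ : ℝ}
    (H : JetRelationTwo f h P Q lam a b σ) :
    (h P.1 P.2 * dY (dY h) P.1 P.2 * dY h Q.1 Q.2 ^ 2
      = h Q.1 Q.2 * dY (dY h) Q.1 Q.2 * dY h P.1 P.2 ^ 2) ∧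
    ((dY h P.1 P.2 * dY (dX h) P.1 P.2 - dX h P.1 P.2 * dY (dY h) P.1 P.2) ^ 2
        * (dY h Q.1 Q.2 ^ 4 * h Q.1 Q.2)
      = (dY h Q.1 Q.2 * dY (dX h) Q.1 Q.2 - dX h Q.1 Q.2 * dY (dY h) Q.1 Q.2) ^ 2
        * (dY h P.1 P.2 ^ 4 * h P.1 P.2)) ∧
    ((dY h P.1 P.2 ^ 2 * (dX (dX h) P.1 P.2 - dY f P.1 P.2 * dY h P.1 P.2)
        - 2 * dX h P.1 P.2 * dY h P.1 P.2 * dY (dX h) P.1 P.2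
        + dX h P.1 P.2 ^ 2 * dY (dY h) P.1 P.2) * (dY h Q.1 Q.2 ^ 2 * h Q.1 Q.2 ^ 2)
      = (dY h Q.1 Q.2 ^ 2 * (dX (dX h) Q.1 Q.2 - dY f Q.1 Q.2 * dY h Q.1 Q.2)
        - 2 * dX h Q.1 Q.2 * dY h Q.1 Q.2 * dY (dX h) Q.1 Q.2
        + dX h Q.1 Q.2 ^ 2 * dY (dY h) Q.1 Q.2) * (dY h P.1 P.2 ^ 2 * h P.1 P.2 ^ 2)) := by
  obtain ⟨⟨-, -, hσ, h0, hx, hy⟩, hxx, hxy, hyy⟩ := H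
  generalize dX (dX h) P.1 P.2 - dY f P.1 P.2 * dY h P.1 P.2 = Hxx at *
  have hy2 : dY h P.1 P.2 ^ 2 = a ^ 4 * lam ^ 6 * dY h Q.1 Q.2 ^ 2 := by
    rw [← hy]
    linear_combination (a ^ 4 * lam ^ 6 * dY h Q.1 Q.2 ^ 2) * hσ
  have hyxy : dY h P.1 P.2 * dY (dX h) P.1 P.2 = a ^ 4 * lam ^ 7 * dY h Q.1 Q.2 *
      (a * dY (dX h) Q.1 Q.2 + b * dY (dY h) Q.1 Q.2) := by
    rw [← hy, ← hxy]
    linear_combination (a ^ 4 * lam ^ 7 * dY h Q.1 Q.2 *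
      (a * dY (dX h) Q.1 Q.2 + b * dY (dY h) Q.1 Q.2)) * hσ
  have hy4 : dY h P.1 P.2 ^ 4 = (a ^ 4 * lam ^ 6 * dY h Q.1 Q.2 ^ 2) ^ 2 := by
    rw [← hy2]
    ring
  have e : 2 * dX h P.1 P.2 * dY h P.1 P.2 * dY (dX h) P.1 P.2
      = 2 * dX h P.1 P.2 * (dY h P.1 P.2 * dY (dX h) P.1 P.2) := by ring
  refine ⟨?_, ?_, ?_⟩
  · rw [hy2, ← h0, ← hyy]
    ring
  · rw [hy4, hyxy, ← h0, ← hyy, ← hx]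
    ring
  · rw [e, hy2, hyxy, ← h0, ← hyy, ← hx, ← hxx]
    ring

theorem dY_div {φ χ : ℝ → ℝ → ℝ} (hO : IsOpen O) (h1 : SmoothOn O φ) (h2 : SmoothOn O χ) {x y : ℝ}
    (hq : (x, y) ∈ O) (h0 : χ x y ≠ 0) : dY (fun x y => φ x y / χ x y) x y
      = (dY φ x y * χ x y - φ x y * dY χ x y) / χ x y ^ 2 :=
  ((h1.hasDerivAt_dY hO hq).fun_div (h2.hasDerivAt_dY hO hq) h0).deriv

theorem dX_div {φ χ : ℝ → ℝ → ℝ} (hO : IsOpen O) (h1 : SmoothOn O φ) (h2 : SmoothOn O χ) {x y : ℝ}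
    (hq : (x, y) ∈ O) (h0 : χ x y ≠ 0) : dX (fun x y => φ x y / χ x y) x y
      = (dX φ x y * χ x y - φ x y * dX χ x y) / χ x y ^ 2 :=
  ((h1.hasDerivAt_dX hO hq).fun_div (h2.hasDerivAt_dX hO hq) h0).deriv

/-- The normal form of `h = f_yy` when the second order invariants are constant. -/
theorem exists_normal_form (hO : IsOpen O) (hc : IsConnected O) (hf : SmoothOn O f)
    (h0 : ∀ q ∈ O, dY (dY f) q.1 q.2 ≠ 0) (h1 : ∀ q ∈ O, dY (dY (dY f)) q.1 q.2 ≠ 0)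
    (H : ∀ P ∈ O, ∀ Q ∈ O, ∃ lam a b σ, JetRelationTwo f (dY (dY f)) P Q lam a b σ) :
    ∃ s κ e : ℝ, s ^ 2 = 1 ∧ e ≠ 0 ∧ κ ≠ 2 ∧ (∀ x y, (x, y) ∈ O → 0 < s * dY (dY f) x y) ∧
      (∀ x y, (x, y) ∈ O → dY (dY (dY f)) x y = e * (s * dY (dY f) x y) ^ κ) ∧
      (∀ x y, (x, y) ∈ O → dY f x y
        = dX (fun x y => dX (dY (dY f)) x y / dY (dY (dY f)) x y) x y
          + 1 / (2 - κ) * (dY (dY f) x y ^ 2 / dY (dY (dY f)) x y)) := by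
  have hh := (hf.dY hO).dY hO
  obtain ⟨z, hz⟩ := hc.nonempty
  have hfy : ∀ x y, (x, y) ∈ O → HasDerivAt (fun t => dY f x t) (dY (dY f) x y) y := fun x y hq =>
    (hf.dY hO).hasDerivAt_dY hO hq
  obtain ⟨s, hs, hpos⟩ : ∃ s : ℝ, s ^ 2 = 1 ∧ ∀ x y, (x, y) ∈ O → 0 < s * dY (dY f) x y := by
    have hm : ∀ q ∈ O, 0 < dY (dY f) z.1 z.2 * dY (dY f) q.1 q.2 := fun q hq =>
      hc.isPreconnected.mul_pos_of_ne_zero (g := Function.uncurry (dY (dY f)))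
        (ContDiffOn.continuousOn hh) h0 hz hq
    rcases lt_or_gt_of_ne (h0 z hz) with hneg | hps
    · refine ⟨-1, by norm_num, fun x y hq => ?_⟩
      have := neg_of_mul_pos_right (hm _ hq) hneg.le
      simp only at this
      linarith
    · refine ⟨1, by norm_num, fun x y hq => ?_⟩
      have := pos_of_mul_pos_right (hm _ hq) hps.le
      simpa using this
  choose lam a b σ hJ using H
  have hinv := fun x y (hq : (x, y) ∈ O) => (hJ (x, y) hq z hz).invariants
  have h0' : ∀ x y, (x, y) ∈ O → dY (dY f) x y ≠ 0 := fun x y hq => h0 _ hq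
  have h1' : ∀ x y, (x, y) ∈ O → dY (dY (dY f)) x y ≠ 0 := fun x y hq => h1 _ hq
  have hz0 := h0 z hz
  have hz1 := h1 z hz
  clear hJ h0 h1
  generalize dY (dY f) = h at *
  obtain ⟨κ, hκ⟩ : ∃ κ, ∀ x y, (x, y) ∈ O → h x y * dY (dY h) x y = κ * dY h x y ^ 2 := by
    refine ⟨h z.1 z.2 * dY (dY h) z.1 z.2 / dY h z.1 z.2 ^ 2, fun x y hq => ?_⟩
    have := (hinv x y hq).1
    simp only at this
    field_simp
    linear_combination this
  obtain ⟨c₂, hc₂⟩ : ∃ c, ∀ x y, (x, y) ∈ O →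
      (dY h x y * dY (dX h) x y - dX h x y * dY (dY h) x y) ^ 2 = c * (dY h x y ^ 4 * h x y) := by
    refine ⟨(dY h z.1 z.2 * dY (dX h) z.1 z.2 - dX h z.1 z.2 * dY (dY h) z.1 z.2) ^ 2 /
      (dY h z.1 z.2 ^ 4 * h z.1 z.2), fun x y hq => ?_⟩
    have := (hinv x y hq).2.1
    simp only at this
    field_simp
    linear_combination this
  obtain ⟨c₁, hc₁⟩ : ∃ c, ∀ x y, (x, y) ∈ O →
      dY h x y ^ 2 * (dX (dX h) x y - dY f x y * dY h x y) - 2 * dX h x y * dY h x y * dY (dX h) x y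
        + dX h x y ^ 2 * dY (dY h) x y = c * (dY h x y ^ 2 * h x y ^ 2) := by
    refine ⟨(dY h z.1 z.2 ^ 2 * (dX (dX h) z.1 z.2 - dY f z.1 z.2 * dY h z.1 z.2)
        - 2 * dX h z.1 z.2 * dY h z.1 z.2 * dY (dX h) z.1 z.2
        + dX h z.1 z.2 ^ 2 * dY (dY h) z.1 z.2) / (dY h z.1 z.2 ^ 2 * h z.1 z.2 ^ 2),
        fun x y hq => ?_⟩
    have := (hinv x y hq).2.2
    simp only at this
    field_simp
    linear_combination this
  clear hinv
  -- the first integral `h_y |h|^(-κ)`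
  let w : ℝ → ℝ := fun t => (s * t) ^ (-κ)
  have hs0 : s ≠ 0 := by
    rintro rfl
    norm_num at hs
  have hw : ∀ x y, (x, y) ∈ O → HasDerivAt w (-κ / h x y * w (h x y)) (h x y) := by
    intro x y hq
    have hp := hpos x y hq
    have hx := h0' x y hq
    refine (((hasDerivAt_id (h x y)).const_mul s).rpow_const (p := -κ) (Or.inl hp.ne')).congr_deriv ?_
    simp only [w, id]
    rw [Real.rpow_sub_one hp.ne']
    field_simp
  have hws : SmoothOn O fun x y => w (h x y) :=
    SmoothOn.comp (S := {t | 0 < s * t}) (ψ := w)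
      ((contDiffOn_const.mul contDiffOn_id).rpow_const_of_ne fun t ht => ne_of_gt ht) hh hpos
  have hwpos : ∀ x y, (x, y) ∈ O → 0 < w (h x y) := fun x y hq => Real.rpow_pos_of_pos (hpos x y hq) _
  let E : ℝ → ℝ → ℝ := fun x y => dY h x y * w (h x y)
  have hE : SmoothOn O E := ContDiffOn.mul (hh.dY hO) hws
  have hEy : ∀ x y, (x, y) ∈ O → dY E x y = 0 := by
    intro x y hq
    have hx := h0' x y hq
    have := ((hh.dY hO).hasDerivAt_dY hO hq).fun_mul (hws.hasDerivAt_dY hO hq)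
    rw [hh.dY_comp hO hq (hw x y hq)] at this
    refine this.deriv.trans ?_
    field_simp
    linear_combination w (h x y) * hκ x y hq
  have hEx : ∀ x y, (x, y) ∈ O → dX E x y
      = (dY h x y * dY (dX h) x y - dX h x y * dY (dY h) x y) / dY h x y ^ 2 * E x y := by
    intro x y hq
    have hx := h0' x y hq
    have hx1 := h1' x y hq
    have := ((hh.dY hO).hasDerivAt_dX hO hq).fun_mul (hws.hasDerivAt_dX hO hq)
    rw [hh.dX_comp hO hq (hw x y hq), hh.dX_dY_comm hO hq] at this
    refine this.deriv.trans ?_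
    simp only [E]
    field_simp
    linear_combination w (h x y) * dX h x y * hκ x y hq
  have hEne : ∀ x y, (x, y) ∈ O → E x y ≠ 0 := fun x y hq =>
    mul_ne_zero (h1' x y hq) (hwpos x y hq).ne'
  have hEsq : ∀ x y, (x, y) ∈ O → dX E x y ^ 2 = c₂ * h x y * E x y ^ 2 := by
    intro x y hq
    have hx1 := h1' x y hq
    rw [hEx x y hq]
    field_simp
    rw [hc₂ x y hq]
    ring
  have hExy : ∀ x y, (x, y) ∈ O → dY (dX E) x y = 0 := by
    intro x y hq
    rw [← hE.dX_dY_comm hO hq, dX_congr hO (χ := fun _ _ => 0) hEy hq]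
    simp [dX]
  -- Both `E` and `E_x` are independent of `y`, so the `y`-derivative of `E_x² = c₂ h E²` is `0 = c₂
  -- h_y E²`.
  have hc₂0 : c₂ = 0 := by
    have hq : (z.1, z.2) ∈ O := hz
    have d1 := ((hE.dX hO).hasDerivAt_dY hO hq).fun_pow 2
    have d2 := ((hh.hasDerivAt_dY hO hq).const_mul c₂).fun_mul ((hE.hasDerivAt_dY hO hq).fun_pow 2)
    have e := dY_congr hO (φ := fun x y => dX E x y ^ 2) (χ := fun x y => c₂ * h x y * E x y ^ 2)
      hEsq hq
    have e' := d1.deriv.symm.trans (e.trans d2.deriv)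
    rw [hExy _ _ hq, hEy _ _ hq] at e'
    simpa [hz1, hEne _ _ hq] using e'
  have hD : ∀ x y, (x, y) ∈ O → dY h x y * dY (dX h) x y - dX h x y * dY (dY h) x y = 0 := by
    intro x y hq
    have := hc₂ x y hq
    rw [hc₂0, zero_mul] at this
    exact pow_eq_zero_iff two_ne_zero |>.1 this
  have hEc : ∀ x y, (x, y) ∈ O → E x y = E z.1 z.2 := by
    intro x y hq
    refine hE.eq_of_dX_dY_eq_zero hO hc.isPreconnected ?_ hEy (p := (x, y)) (q := z) hq hz
    intro x y hq
    rw [hEx x y hq, hD x y hq]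
    ring
  have hq : SmoothOn O fun x y => dX h x y / dY h x y :=
    ContDiffOn.div (hh.dX hO) (hh.dY hO) fun q hq => h1' q.1 q.2 hq
  have hqy : ∀ x y, (x, y) ∈ O → dY (fun x y => dX h x y / dY h x y) x y = 0 := by
    intro x y hxy
    rw [dY_div hO (hh.dX hO) (hh.dY hO) hxy (h1' x y hxy)]
    rw [div_eq_zero_iff]
    left
    linear_combination hD x y hxy
  -- The third invariant contains `f_y` linearly and is solved for it, using that `h_x / h_y`
  -- depends on `x` only.
  have hfq : ∀ x y, (x, y) ∈ O → dY f x y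
      = dX (fun x y => dX h x y / dY h x y) x y - c₁ * (h x y ^ 2 / dY h x y) := by
    intro x y hxy
    have hx1 := h1' x y hxy
    rw [dX_div hO (hh.dX hO) (hh.dY hO) hxy hx1, hh.dX_dY_comm hO hxy]
    field_simp
    apply mul_left_cancel₀ hx1
    linear_combination -hc₁ x y hxy - dX h x y * hD x y hxy
  -- The `y`-derivative of `hfq` is `h = -c₁ (2 - κ) h`, because `h h_yy = κ h_y²`. In particular `κ
  -- ≠ 2`.
  have hck : -c₁ * (2 - κ) = 1 := by
    have hxy : (z.1, z.2) ∈ O := hz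
    have d2 := ((hq.dX hO).hasDerivAt_dY hO hxy).fun_sub
      ((((hh.hasDerivAt_dY hO hxy).fun_pow 2).fun_div ((hh.dY hO).hasDerivAt_dY hO hxy)
        hz1).const_mul c₁)
    have e := (dY_congr hO hfq hxy).trans d2.deriv
    rw [← hq.dX_dY_comm hO hxy, dX_congr hO (χ := fun _ _ => 0) hqy hxy] at e
    rw [show dY (dY f) z.1 z.2 = h z.1 z.2 from (hfy _ _ hxy).deriv] at e
    simp [dX] at e
    have := hκ _ _ hxy
    field_simp at e
    apply mul_left_cancel₀ (pow_ne_zero 2 hz1)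
    linear_combination -e - c₁ * this
  refine ⟨s, κ, E z.1 z.2, hs, hEne _ _ hz, ?_, hpos, ?_, ?_⟩
  · rintro rfl
    norm_num at hck
  · intro x y hxy
    rw [← hEc x y hxy]
    simp only [E, w]
    rw [Real.rpow_neg (hpos x y hxy).le]
    have := (Real.rpow_pos_of_pos (hpos x y hxy) κ).ne'
    field_simp
  · intro x y hxy
    have h2 : 2 - κ ≠ 0 := by
      intro h
      rw [h] at hck
      norm_num at hck
    rw [hfq x y hxy]
    have : 1 / (2 - κ) = -c₁ := by
      field_simp
      linear_combination -hck
    rw [this]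
    ring

end Classification

/-- Rescaling `x` multiplies a potential by `μ² > 0`, so its coefficient can be normalised to a
sign. -/
theorem exists_sign_mul_sq {r : ℝ} (hr : r ≠ 0) :
    ∃ s μ : ℝ, (s = 1 ∨ s = -1) ∧ μ ≠ 0 ∧ μ ^ 2 * s = r := by
  rcases lt_or_gt_of_ne hr with h | h
  · refine ⟨-1, Real.sqrt (-r), Or.inr rfl, (Real.sqrt_pos.2 (neg_pos.2 h)).ne', ?_⟩
    rw [Real.sq_sqrt (neg_pos.2 h).le]
    ring
  · refine ⟨1, Real.sqrt r, Or.inl rfl, (Real.sqrt_pos.2 h).ne', ?_⟩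
    rw [Real.sq_sqrt h.le]
    ring

section Classification

variable {O : Set (ℝ × ℝ)} {hO : IsOpen O} {f : ℝ → ℝ → ℝ}
  {hf : ContDiffOn ℝ ∞ (Function.uncurry f) O}

/-- The local models of Walker manifolds whose `f_y` is, up to a term that is removed by a change
of coordinates, a power of an adapted coordinate `Y`. -/
theorem isLocallyIsometricTo_of_power {Y : ℝ → ℝ → ℝ} {σ m ε : ℝ} (hσ : σ ^ 2 = 1)
    (hm : m ≠ 0) (hε1 : ε ≠ 1) (hε2 : ε ≠ 2) (hY : SmoothOn O Y)
    (hYpos : ∀ x y, (x, y) ∈ O → 0 < Y x y) (hYy : ∀ x y, (x, y) ∈ O → dY Y x y = σ)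
    (hfY : ∀ x y, (x, y) ∈ O → dY f x y = σ * dX (dX Y) x y + m * Y x y ^ (ε - 1)) :
    ∃ s : ℝ, (s = 1 ∨ s = -1) ∧ ((walker O hO f hf).IsLocallyIsometricTo (walkerLog s) ∨
      ∃ ε : ℝ, ε ≠ 0 ∧ ε ≠ 1 ∧ ε ≠ 2 ∧
        (walker O hO f hf).IsLocallyIsometricTo (walkerPow s ε)) := by
  have hσ0 : σ ≠ 0 := by
    rintro rfl
    norm_num at hσ
  -- For `ε = 0` the power `Y⁻¹` integrates to a logarithm.
  by_cases hε : ε = 0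
  · subst hε
    obtain ⟨s, μ, hs, hμ, e⟩ := exists_sign_mul_sq (mul_ne_zero hσ0 hm)
    refine ⟨s, hs, Or.inl ?_⟩
    refine isLocallyIsometricTo_of_coordinate (g := fun y => s * Real.log y)
      (g' := fun y => s * y⁻¹) hσ hμ hY hYy (fun x y hq t => hYpos x y hq)
      (fun x y hq => (Real.hasDerivAt_log (hYpos x y hq).ne').const_mul s) fun x y hq => ?_
    rw [hfY x y hq, zero_sub, Real.rpow_neg_one]
    linear_combination (-σ * (Y x y)⁻¹) * e - m * (Y x y)⁻¹ * hσ
  · obtain ⟨s, μ, hs, hμ, e⟩ := exists_sign_mul_sq (div_ne_zero (mul_ne_zero hσ0 hm) hε)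
    refine ⟨s, hs, Or.inr ⟨ε, hε, hε1, hε2, ?_⟩⟩
    refine isLocallyIsometricTo_of_coordinate (g := fun y => s * y ^ ε)
      (g' := fun y => s * (ε * y ^ (ε - 1))) hσ hμ hY hYy (fun x y hq t => hYpos x y hq)
      (fun x y hq => (Real.hasDerivAt_rpow_const (Or.inl (hYpos x y hq).ne')).const_mul s)
      fun x y hq => ?_
    rw [eq_div_iff hε] at e
    rw [hfY x y hq]
    linear_combination (-σ * Y x y ^ (ε - 1)) * e - m * Y x y ^ (ε - 1) * hσ

theorem isLocallyIsometricTo_model (hc : IsConnected O)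
    (h0 : ∀ q ∈ O, dY (dY f) q.1 q.2 ≠ 0) (h1 : ∀ q ∈ O, dY (dY (dY f)) q.1 q.2 ≠ 0)
    (h : (walker O hO f hf).IsHomothetyCurvatureHomogeneous 2) :
    ∃ s : ℝ, (s = 1 ∨ s = -1) ∧
      ((∃ a : ℝ, a ≠ 0 ∧ (walker O hO f hf).IsLocallyIsometricTo (walkerExp s a)) ∨
        (walker O hO f hf).IsLocallyIsometricTo (walkerLog s) ∨
        (∃ ε : ℝ, ε ≠ 0 ∧ ε ≠ 1 ∧ ε ≠ 2 ∧
          (walker O hO f hf).IsLocallyIsometricTo (walkerPow s ε))) := by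
  have hf' : SmoothOn O f := hf
  have hh := (hf'.dY hO).dY hO
  obtain ⟨s, κ, e, hs, he, hκ, hpos, hhy, hfy⟩ := exists_normal_form hO hc hf' h0 h1
    fun P hP Q hQ => h.jetRelationTwo hP hQ (h0 Q hQ)
  have h0' : ∀ x y, (x, y) ∈ O → dY (dY f) x y ≠ 0 := fun x y hq => h0 _ hq
  have h1' : ∀ x y, (x, y) ∈ O → dY (dY (dY f)) x y ≠ 0 := fun x y hq => h1 _ hq
  clear h h0 h1
  have hs0 : s ≠ 0 := by
    rintro rfl
    norm_num at hs
  generalize dY (dY f) = h at *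
  -- a function `ψ(h)` with `ψ'(h) h_y = σ` serves as the new coordinate
  have hchart : ∀ {ψ ψ' : ℝ → ℝ} {σ : ℝ}, σ ^ 2 = 1 →
      (∀ x y, (x, y) ∈ O → HasDerivAt ψ (ψ' (h x y)) (h x y)) →
      (∀ x y, (x, y) ∈ O → ψ' (h x y) * dY h x y = σ) →
      (∀ x y, (x, y) ∈ O → dY (fun x y => ψ (h x y)) x y = σ) ∧
      ∀ x y, (x, y) ∈ O → dX (fun x y => dX h x y / dY h x y) x y
        = σ * dX (dX fun x y => ψ (h x y)) x y := by
    intro ψ ψ' σ hσ hψ hψσ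
    refine ⟨fun x y hq => by rw [hh.dY_comp hO hq (hψ x y hq), hψσ x y hq], fun x y hq => ?_⟩
    have e1 : ∀ x y, (x, y) ∈ O → dX h x y / dY h x y = σ * dX (fun x y => ψ (h x y)) x y := by
      intro x y hq
      have := h1' x y hq
      rw [hh.dX_comp hO hq (hψ x y hq)]
      field_simp
      linear_combination (-σ * dX h x y) * hψσ x y hq - dX h x y * hσ
    rw [dX_congr hO e1 hq]
    simp [dX]
  by_cases hκ1 : κ = 1
  · subst hκ1
    have ha : s * e ≠ 0 := mul_ne_zero hs0 he
    -- For `κ = 1`, `h_y = s e h`, so `h` is exponential in `y` with rate `s e` and sign `s`; the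
    -- coordinate is `log |h| / (s e)`.
    refine ⟨s, mul_self_eq_one_iff.1 (by rw [← sq, hs]), Or.inl ⟨s * e, ha, ?_⟩⟩
    have hψ : ∀ x y, (x, y) ∈ O → HasDerivAt (fun t => Real.log (s * t) / (s * e))
        (1 / (s * e * h x y)) (h x y) := by
      intro x y hq
      have := h0' x y hq
      refine (((hasDerivAt_id (h x y)).const_mul s).log (hpos x y hq).ne').div_const (s * e)
        |>.congr_deriv ?_
      simp only [id]
      field_simp
    obtain ⟨k1, k2⟩ := hchart (ψ' := fun t => 1 / (s * e * t)) (σ := 1) (one_pow 2) hψ (by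
      intro x y hq
      have := h0' x y hq
      rw [hhy x y hq, Real.rpow_one]
      field_simp)
    refine isLocallyIsometricTo_of_coordinate (σ := 1) (μ := 1 / (s * e))
      (g := fun y => s * Real.exp (s * e * y))
      (g' := fun y => s * (Real.exp (s * e * y) * (s * e))) (one_pow 2) (by positivity) ?_ k1
      (fun _ _ _ _ => Set.mem_univ _)
      (fun x y _ => (((hasDerivAt_id _).const_mul (s * e)).exp.const_mul s).congr_deriv
        (by simp)) ?_
    · exact SmoothOn.comp (S := {t | 0 < s * t}) (ψ := fun t => Real.log (s * t) / (s * e))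
        (((contDiffOn_const.mul contDiffOn_id).log fun t ht => ne_of_gt ht).div_const _) hh hpos
    · intro x y hq
      have := h0' x y hq
      rw [hfy x y hq, k2 x y hq, mul_div_cancel₀ _ ha, Real.exp_log (hpos x y hq), hhy x y hq,
        Real.rpow_one]
      field_simp
      norm_num
      linear_combination -h x y * hs
  · have hp : 1 - κ ≠ 0 := sub_ne_zero.2 (Ne.symm hκ1)
    have h2κ : 2 - κ ≠ 0 := sub_ne_zero.2 (Ne.symm hκ)
    have hpe : (1 - κ) * e ≠ 0 := mul_ne_zero hp he
    -- The absolute value keeps `Y = |h|^(1 - κ) / A` positive; the sign goes into `σ = Y_y`.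
    set A := |(1 - κ) * e| with hA
    have hApos : 0 < A := abs_pos.2 hpe
    have hA2 : A ^ 2 = ((1 - κ) * e) ^ 2 := sq_abs _
    set σ := s * ((1 - κ) * e) / A with hσ_def
    have hσ : σ ^ 2 = 1 := by
      rw [hσ_def, div_pow, mul_pow, hs, hA2]
      field_simp
    have hψ : ∀ x y, (x, y) ∈ O → HasDerivAt (fun t => (s * t) ^ (1 - κ) / A)
        (s * (1 - κ) * (s * h x y) ^ (-κ) / A) (h x y) := by
      intro x y hq
      refine ((((hasDerivAt_id (h x y)).const_mul s).rpow_const (p := 1 - κ)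
        (Or.inl (hpos x y hq).ne')).div_const A).congr_deriv ?_
      rw [show 1 - κ - 1 = -κ by ring]
      simp
    obtain ⟨k1, k2⟩ := hchart (ψ' := fun t => s * (1 - κ) * (s * t) ^ (-κ) / A) hσ hψ (by
      intro x y hq
      rw [hhy x y hq, Real.rpow_neg (hpos x y hq).le]
      have := (Real.rpow_pos_of_pos (hpos x y hq) κ).ne'
      rw [hσ_def]
      field_simp)
    -- Since `h² / h_y` is a multiple of `|h|^(2 - κ)`, it is one of `Y^((2 - κ) / (1 - κ))`, and
    -- this exponent is `ε - 1`. Thus `ε = 1` would mean `κ = 2`, and `ε = 2` is impossible.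
    have hε : 2 + 1 / (1 - κ) - 1 = (2 - κ) / (1 - κ) := by
      field_simp
      ring
    obtain ⟨s', hs', hl⟩ := isLocallyIsometricTo_of_power (hO := hO) (hf := hf)
      (Y := fun x y => (s * h x y) ^ (1 - κ) / A) (ε := 2 + 1 / (1 - κ))
      (m := A ^ ((2 - κ) / (1 - κ)) / ((2 - κ) * e)) hσ
      (div_ne_zero (Real.rpow_pos_of_pos hApos _).ne' (mul_ne_zero h2κ he)) (by
        intro h
        rw [h, sub_self, eq_comm, div_eq_zero_iff] at hε
        exact hε.elim h2κ hp) (by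
        intro h
        have : 1 / (1 - κ) ≠ 0 := by positivity
        exact this (by linarith))
      (SmoothOn.comp (S := {t | 0 < s * t}) (ψ := fun t => (s * t) ^ (1 - κ) / A)
        (((contDiffOn_const.mul contDiffOn_id).rpow_const_of_ne fun t ht => ne_of_gt ht).div_const _)
        hh hpos)
      (fun x y hq => div_pos (Real.rpow_pos_of_pos (hpos x y hq) _) hApos) k1 (by
        intro x y hq
        have hx := hpos x y hq
        have hx0 := h0' x y hq
        rw [hfy x y hq, k2 x y hq, hε, Real.div_rpow (Real.rpow_pos_of_pos hx _).le hApos.le,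
          ← Real.rpow_mul hx.le, mul_div_cancel₀ _ hp, Real.rpow_sub hx, hhy x y hq]
        have e1 := (Real.rpow_pos_of_pos hApos ((2 - κ) / (1 - κ))).ne'
        have e2 := (Real.rpow_pos_of_pos hx κ).ne'
        rw [Real.rpow_two, mul_pow, hs]
        field_simp)
    exact ⟨s', hs', Or.inr hl⟩

end Classification

end
theorem theorem1p9 :
    (∀ (O : Set (ℝ × ℝ)) (hO : IsOpen O) (f : ℝ → ℝ → ℝ)
        (hf : ContDiffOn ℝ ∞ (Function.uncurry f) O),
      IsConnected O →
      (∀ q ∈ O, dY (dY f) q.1 q.2 ≠ 0) →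
      (¬ ∃ c : ℝ, ∀ q ∈ O, dY (dY f) q.1 q.2 = c) →
      -- (1)
      ((∀ q ∈ O, dY (dY (dY f)) q.1 q.2 ≠ 0) →
        (walker O hO f hf).IsHomothetyCurvatureHomogeneous 1) ∧
      -- (2)
      ((∀ x : ℝ, IsPreconnected {y : ℝ | (x, y) ∈ O}) →
        ∀ α : ℝ → ℝ, (∀ q ∈ O, dY (dY f) q.1 q.2 = α q.1) → (∀ q ∈ O, deriv α q.1 ≠ 0) →
          ((walker O hO f hf).IsHomothetyCurvatureHomogeneous 1 ↔
            IsInverseSquareQuadratic O f) ∧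
          (IsInverseSquareQuadratic O f → (walker O hO f hf).IsLocallyHomogeneous)) ∧
      -- (3)
      ((∀ q ∈ O, dY (dY (dY f)) q.1 q.2 ≠ 0) →
        (walker O hO f hf).IsHomothetyCurvatureHomogeneous 2 →
        ∃ s : ℝ, (s = 1 ∨ s = -1) ∧
          ((∃ a : ℝ, a ≠ 0 ∧ (walker O hO f hf).IsLocallyIsometricTo (walkerExp s a)) ∨
            (walker O hO f hf).IsLocallyIsometricTo (walkerLog s) ∨
            (∃ ε : ℝ, ε ≠ 0 ∧ ε ≠ 1 ∧ ε ≠ 2 ∧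
              (walker O hO f hf).IsLocallyIsometricTo (walkerPow s ε))))) ∧
    -- the model manifolds of (3)
    (∀ s : ℝ, (s = 1 ∨ s = -1) →
      (∀ a : ℝ, a ≠ 0 → (walkerExp s a).IsHomogeneous) ∧
      ((walkerLog s).IsHomothetyHomogeneous ∧ ¬ (walkerLog s).IsLocallyHomogeneous) ∧
      (∀ ε : ℝ, ε ≠ 0 → ε ≠ 1 → ε ≠ 2 →
        (walkerPow s ε).IsHomothetyHomogeneous ∧
          ¬ (walkerPow s ε).IsLocallyHomogeneous)) := by
  refine ⟨fun O hO f hf hc h2 _ => ⟨fun h3 => ?_, fun hslice α hα hα1 => ⟨⟨fun h => ?_, fun h => ?_⟩,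
    walker_isLocallyHomogeneous⟩, isLocallyIsometricTo_model hc h2⟩, fun s hs => ?_⟩
  · exact walker_isHomothetyCurvatureHomogeneous_one hc.isPreconnected h2 h3
  · exact isInverseSquareQuadratic_of_jetRelation hO hc hf hslice h2 hα hα1 fun P hP Q hQ =>
      h.jetRelation hP hQ (h2 Q hQ)
  · exact isHomothetyCurvatureHomogeneous_one_of_jetRelation fun P hP Q hQ =>
      jetRelation_of_isInverseSquareQuadratic hO h hP hQ
  · have hs0 : s ≠ 0 := by rcases hs with rfl | rfl <;> norm_num
    exact ⟨fun a _ => walkerExp_isHomogeneous s a,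
      ⟨walkerLog_isHomothetyHomogeneous s, not_isLocallyHomogeneous_walkerLog hs0⟩,
      fun ε h0 h1 h2 => ⟨walkerPow_isHomothetyHomogeneous s ε,
        not_isLocallyHomogeneous_walkerPow hs0 h0 h1 h2⟩⟩
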